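/- Fix an algebraic closure $\overline{\mathbb Q}$ of $\mathbb Q$. For a positive integer $n$, the noncuspidal $\overline{\mathbb Q}$-points of the modular curve $X_0(n)$ are the isomorphism classes of pairs $(E,C)$, where $E/\overline{\mathbb Q}$ is an elliptic curve and $C\subset E(\overline{\mathbb Q})$ is a cyclic subgroup of order $n$. If $n=de$ with $\gcd(d,e)=1$ and $C=C_d+C_e$ with $C_d$, $C_e$ of orders $d$, $e$, the Atkin–Lehner involution $w_d$ sends $(E,C)$ to $(\mu(E),\mu(E[d])+\mu(C_e))$, where $\mu$ is the isogeny with domain $E$ and kernel $C_d$. A noncuspidal rational point of $X_0(n)/w_d$ is a pair $\{x,w_d(x)\}$, with $x=(E,C)$ a noncuspidal $\overline{\mathbb Q}$-point of $X_0(n)$, that is invariant under $\mathrm{Gal}(\overline{\mathbb Q}/\mathbb Q)$; an elliptic curve $F$ corresponds to this point if $j(F)=j(E)$ or $j(F)=j(\mu(E))$. Write $X_0^+(n)=X_0(n)/w_n$. An elliptic curve $E$ over a quadratic field $K\subset\overline{\mathbb Q}$ is called a $\mathbb Q$-curve of degree $d$ if there is a cyclic isogeny of degree $d$ over $\overline{\mathbb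 Q}$ from $E$ to its Galois conjugate $E^\sigma$, where $\sigma$ generates $\mathrm{Gal}(K/\mathbb Q)$. Proposition. Let $m$ and $d$ be coprime positive integers, and let $K\subset\overline{\mathbb Q}$ be a quadratic field. Let $E$ be an elliptic curve over $K$ without complex multiplication (over $\overline{\mathbb Q}$) that is a $\mathbb Q$-curve of degree $d$, and suppose that there is a cyclic isogeny $E\to E_1$ of degree $m$ defined over $K$, where $E_1$ is an elliptic curve over $K$. Then there is a positive divisor $k$ of $m$ such that $E$ corresponds to a noncuspidal rational point of $X_0\left(\frac mk d\right)/w_d$ and $E_1$ corresponds to a noncuspidal rational point of $X_0^+(k^2d)$. -/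

import Mathlib

open Polynomial
open scoped Polynomial.Bivariate

/-- The algebraic closure of `ℚ` that contains all number fields and coordinates below. -/
abbrev QBar : Type := AlgebraicClosure ℚ

noncomputable instance : DecidableEq QBar := Classical.decEq _

namespace EllCurve

open WeierstrassCurve

lemma aevalAeval_conj {L : Type*} [Field L] (τ : L ≃+* L) (p : L[X][Y]) (x y : L) :
    aevalAeval (τ x) (τ y) (p.map (mapRingHom (τ : L →+* L))) = τ (aevalAeval x y p) := by
  rw [coe_aevalAeval_eq_evalEval, coe_aevalAeval_eq_evalEval]
  exact map_mapRingHom_evalEval (τ : L →+* L) p x y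

section Points

variable {L : Type*} [Field L] [DecidableEq L]

/-- The group isomorphism `W(L) ≃ W^τ(L)`, `(x, y) ↦ (τ x, τ y)`, for a field automorphism `τ` of
`L`, where `W^τ` is the curve `W` with `τ` applied to its coefficients. -/
noncomputable def conjPointHom (τ : L ≃+* L) (W : Affine L) :
    W.Point →+ (Affine.Point (W.map (τ : L →+* L))) where
  toFun P := match P with
    | 0 => 0
    | .some x y h => .some (τ x) (τ y) ((Affine.map_nonsingular W (f := (τ : L →+* L))
        τ.injective x y).mpr h)
  map_zero' := rfl
  map_add' := by
    rintro (_ | ⟨x₁, y₁, h₁⟩) (_ | ⟨x₂, y₂, h₂⟩)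
    any_goals rfl
    have hneg := Affine.map_negY (W' := W) (τ : L →+* L) x₂ y₂
    have hs := Affine.map_slope (W := W) (τ : L →+* L) x₁ x₂ y₁ y₂
    by_cases hxy : x₁ = x₂ ∧ y₁ = W.negY x₂ y₂
    · rw [Affine.Point.add_of_Y_eq hxy.left hxy.right]
      refine (Affine.Point.add_of_Y_eq (congrArg τ hxy.left) ?_).symm
      rw [hxy.right]
      exact hneg.symm
    · rw [Affine.Point.add_some hxy]
      have hxy' : ¬(τ x₁ = τ x₂ ∧ τ y₁ = (W.map (τ : L →+* L)).toAffine.negY (τ x₂) (τ y₂)) := by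
        rintro ⟨h, h'⟩
        exact hxy ⟨τ.injective h, τ.injective (h'.trans hneg)⟩
      have hx := Affine.map_addX (W' := W) (τ : L →+* L) x₁ x₂ (W.slope x₁ x₂ y₁ y₂)
      have hy := Affine.map_addY (W' := W) (τ : L →+* L) x₁ y₁ x₂ (W.slope x₁ x₂ y₁ y₂)
      rw [← hs] at hx hy
      refine Eq.trans ?_ (Affine.Point.add_some hxy').symm
      exact (Affine.Point.some.injEq ..).mpr ⟨hx.symm, hy.symm⟩

lemma conjPointHom_bijective (τ : L ≃+* L) (W : Affine L) :
    Function.Bijective (conjPointHom τ W) := by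
  constructor
  · rintro (_ | ⟨x₁, y₁, h₁⟩) (_ | ⟨x₂, y₂, h₂⟩) h
    · rfl
    · exact absurd h (by rintro ⟨⟩)
    · exact absurd h (by rintro ⟨⟩)
    · have h' := Affine.Point.some.inj h
      have hx := τ.injective h'.1
      have hy := τ.injective h'.2
      subst hx hy
      rfl
  · rintro (_ | ⟨x, y, h⟩)
    · exact ⟨0, rfl⟩
    · have h' : W.Nonsingular (τ.symm x) (τ.symm y) := by
        rw [← Affine.map_nonsingular W (f := (τ : L →+* L)) τ.injective]
        simpa using h
      refine ⟨.some _ _ h', ?_⟩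
      change Affine.Point.some (τ (τ.symm x)) (τ (τ.symm y)) _ = _
      simp

/-- `conjPointHom` as an isomorphism of groups. -/
noncomputable def conjPoint (τ : L ≃+* L) (W : Affine L) :
    W.Point ≃+ (Affine.Point (W.map (τ : L →+* L))) :=
  AddEquiv.ofBijective (conjPointHom τ W) (conjPointHom_bijective τ W)

lemma conjPoint_some (τ : L ≃+* L) (W : Affine L) (x y : L) (h : W.Nonsingular x y) :
    conjPoint τ W (.some x y h) = .some (τ x) (τ y)
      ((Affine.map_nonsingular W (f := (τ : L →+* L)) τ.injective x y).mpr h) := rfl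

end Points

section Isogeny

variable {L : Type*} [Field L] [DecidableEq L]

/-- An isogeny, defined over the subfield `k` of the algebraically closed field `L`, between the
elliptic curves `W₁` and `W₂`: a group homomorphism `W₁(L) → W₂(L)` that is given by rational
functions `(x, y) ↦ (f(x, y) / h(x, y), g(x, y) / h(x, y))` with coefficients in `k`, outside the
finitely many points at which the common denominator `h` vanishes. (Such a homomorphism is a
nonconstant morphism of curves, as rational maps between smooth projective curves extend.) -/
structure Isogeny (k : Type*) [Field k] [Algebra k L] (W₁ W₂ : Affine L) where
  /-- The map on `L`-points. -/
  hom : W₁.Point →+ W₂.Point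
  rational : ∃ f g h : k[X][Y],
    {p : L × L | W₁.Equation p.1 p.2 ∧ aevalAeval p.1 p.2 h = 0}.Finite ∧
    ∀ (x y : L) (hxy : W₁.Nonsingular x y), aevalAeval x y h ≠ 0 →
      ∃ hxy' : W₂.Nonsingular (aevalAeval x y f / aevalAeval x y h)
          (aevalAeval x y g / aevalAeval x y h),
        hom (.some x y hxy) = .some _ _ hxy'

/-- The isogeny is cyclic of degree `n`, i.e. its kernel is a cyclic group of order `n`. (Over a
field of characteristic zero the degree of an isogeny is the order of its kernel.) -/
def Isogeny.IsCyclicOfDegree {k : Type*} [Field k] [Algebra k L] {W₁ W₂ : Affine L}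
    (φ : Isogeny k W₁ W₂) (n : ℕ) : Prop :=
  IsAddCyclic φ.hom.ker ∧ Nat.card φ.hom.ker = n

/-- The conjugate isogeny `φ^τ : W₁^τ → W₂^τ`. -/
noncomputable def Isogeny.conj (τ : L ≃+* L) {W₁ W₂ : Affine L} (φ : Isogeny L W₁ W₂) :
    Isogeny L (W₁.map (τ : L →+* L)) (W₂.map (τ : L →+* L)) where
  hom := ((conjPoint τ W₂ : _ →+ _).comp φ.hom).comp ((conjPoint τ W₁).symm : _ →+ _)
  rational := by
    obtain ⟨f, g, h, hfin, hφ⟩ := φ.rational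
    refine ⟨f.map (mapRingHom (τ : L →+* L)), g.map (mapRingHom (τ : L →+* L)),
      h.map (mapRingHom (τ : L →+* L)), ?_, ?_⟩
    · refine (hfin.image (Prod.map τ τ)).subset ?_
      rintro ⟨x, y⟩ ⟨hxy, hh⟩
      obtain ⟨x, rfl⟩ := τ.surjective x
      obtain ⟨y, rfl⟩ := τ.surjective y
      refine ⟨(x, y), ⟨(Affine.map_equation W₁ (f := (τ : L →+* L)) τ.injective x y).mp hxy, ?_⟩,
        rfl⟩
      rw [aevalAeval_conj] at hh
      exact (map_eq_zero_iff τ τ.injective).mp hh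
    · intro x y hxy hh
      obtain ⟨x, rfl⟩ := τ.surjective x
      obtain ⟨y, rfl⟩ := τ.surjective y
      rw [aevalAeval_conj] at hh
      have hxy₁ := (Affine.map_nonsingular W₁ (f := (τ : L →+* L)) τ.injective x y).mp hxy
      obtain ⟨hxy₂, e⟩ := hφ x y hxy₁ (fun h0 => hh (by rw [h0, map_zero]))
      simp only [aevalAeval_conj, ← map_div₀]
      refine ⟨(Affine.map_nonsingular W₂ (f := (τ : L →+* L)) τ.injective _ _).mpr hxy₂, ?_⟩
      have e₁ : (conjPoint τ W₁).symm (.some (τ x) (τ y) hxy) = .some x y hxy₁ := by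
        rw [AddEquiv.symm_apply_eq]; rfl
      change conjPoint τ W₂ (φ.hom ((conjPoint τ W₁).symm (.some (τ x) (τ y) hxy))) = _
      rw [e₁, e]; rfl

lemma Isogeny.conj_conjPoint (τ : L ≃+* L) {W₁ W₂ : Affine L} (φ : Isogeny L W₁ W₂)
    (P : W₁.Point) : (φ.conj τ).hom (conjPoint τ W₁ P) = conjPoint τ W₂ (φ.hom P) := by
  change conjPoint τ W₂ (φ.hom ((conjPoint τ W₁).symm (conjPoint τ W₁ P))) = _
  rw [AddEquiv.symm_apply_apply]

lemma map_conj (τ : L ≃+* L) {W₁ W₂ : Affine L} (φ : Isogeny L W₁ W₂)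
    (C : AddSubgroup W₁.Point) :
    (C.map (conjPoint τ W₁).toAddMonoidHom).map (φ.conj τ).hom =
      (C.map φ.hom).map (conjPoint τ W₂).toAddMonoidHom := by
  rw [AddSubgroup.map_map, AddSubgroup.map_map]
  congr 1
  exact AddMonoidHom.ext fun P => φ.conj_conjPoint τ P

lemma map_ker_conj (τ : L ≃+* L) {W₁ W₂ : Affine L} (φ : Isogeny L W₁ W₂) :
    (φ.conj τ).hom.ker = φ.hom.ker.map (conjPoint τ W₁).toAddMonoidHom := by
  ext P
  obtain ⟨P, rfl⟩ := (conjPoint τ W₁).surjective P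
  have e := φ.conj_conjPoint τ P
  constructor
  · intro h
    exact ⟨P, (conjPoint τ W₂).injective ((e.symm.trans h).trans (map_zero _).symm), rfl⟩
  · rintro ⟨P', h, h'⟩
    obtain rfl := (conjPoint τ W₁).injective h'
    exact e.trans ((congrArg _ h).trans (map_zero _))

lemma map_torsionBy {A B : Type*} [AddCommGroup A] [AddCommGroup B] (e : A ≃+ B) (d : ℤ) :
    (AddSubgroup.torsionBy A d).map e.toAddMonoidHom = AddSubgroup.torsionBy B d := by
  ext b
  obtain ⟨a, rfl⟩ := e.surjective b
  constructor
  · rintro ⟨a', h, h'⟩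
    obtain rfl := e.injective h'
    have h : d • a' = 0 := h
    change d • e a' = 0
    rw [← map_zsmul, h, map_zero]
  · intro h
    have h : d • e a = 0 := h
    refine ⟨a, ?_, rfl⟩
    change d • a = 0
    apply e.injective
    rw [map_zsmul, h, map_zero]

lemma map_inf_conj (τ : L ≃+* L) (W : Affine L) (C : AddSubgroup W.Point) (d : ℤ) :
    (C ⊓ AddSubgroup.torsionBy W.Point d).map (conjPoint τ W).toAddMonoidHom =
      C.map (conjPoint τ W).toAddMonoidHom ⊓ AddSubgroup.torsionBy _ d := by
  have h := AddSubgroup.map_inf C (AddSubgroup.torsionBy W.Point d)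
    (conjPoint τ W).toAddMonoidHom (conjPoint τ W).injective
  rw [h, map_torsionBy]

lemma map_sup_conj (τ : L ≃+* L) (W : Affine L) (C : AddSubgroup W.Point) (d : ℤ) :
    (AddSubgroup.torsionBy W.Point d ⊔ C).map (conjPoint τ W).toAddMonoidHom =
      AddSubgroup.torsionBy _ d ⊔ C.map (conjPoint τ W).toAddMonoidHom := by
  rw [AddSubgroup.map_sup, map_torsionBy]

end Isogeny

section QCurves

variable {K : IntermediateField ℚ QBar}

/-- The elliptic curve `E` over the number field `K` has complex multiplication: it has an
endomorphism over `QBar` that is not multiplication by an integer. -/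
def HasCM (E : WeierstrassCurve K) : Prop :=
  ∃ φ : Isogeny QBar (E.baseChange QBar) (E.baseChange QBar),
    ∀ n : ℤ, ∃ P : Affine.Point (E.baseChange QBar), φ.hom P ≠ n • P

/-- The elliptic curve `E` over the quadratic field `K` is a `ℚ`-curve of degree `d`: there is a
cyclic isogeny of degree `d` over `QBar` from `E` to its Galois conjugate `E^σ`, where `σ` is the
nontrivial automorphism of `K`. -/
def IsQCurveOfDegree (E : WeierstrassCurve K) (d : ℕ) : Prop :=
  ∃ σ : K ≃ₐ[ℚ] K, σ ≠ 1 ∧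
    ∃ μ : Isogeny QBar (E.baseChange QBar)
      ((E.map ((σ : K ≃+* K) : K →+* K)).baseChange QBar), μ.IsCyclicOfDegree d

end QCurves

/-! ### The modular curves, as sets of geometric points with Galois action -/

/-- A pair `(E, C)` of an elliptic curve `E` over `QBar` and a cyclic subgroup `C` of order `n`. -/
structure Enhanced (n : ℕ) where
  /-- The elliptic curve. -/
  W : Affine QBar
  isElliptic : W.IsElliptic
  /-- The cyclic subgroup. -/
  C : AddSubgroup W.Point
  isAddCyclic : IsAddCyclic C
  card_eq : Nat.card C = n

attribute [instance] Enhanced.isElliptic Enhanced.isAddCyclic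

namespace Enhanced

variable {n : ℕ}

/-- The pairs `(E, C)` and `(E', C')` are isomorphic. -/
def Iso (x y : Enhanced n) : Prop :=
  ∃ (φ : Isogeny QBar x.W y.W) (ψ : Isogeny QBar y.W x.W),
    (∀ P, ψ.hom (φ.hom P) = P) ∧ (∀ Q, φ.hom (ψ.hom Q) = Q) ∧ x.C.map φ.hom = y.C

/-- `y` is (up to isomorphism) the image of `x = (E, C)` under the Atkin-Lehner operation `w_d`,
where `n = d * m` with `d`, `m` coprime: with `C_d = C ∩ E[d]` (the subgroup of order `d` of `C`)
and `C = C_d + C_m`, there is an isogeny `μ` from `E` with kernel `C_d` onto the curve of `y`, and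
the subgroup of `y` is `μ(E[d]) + μ(C_m)`, which is `μ(E[d] + C)`. -/
def IsAtkinLehner (d : ℕ) (x y : Enhanced n) : Prop :=
  ∃ μ : Isogeny QBar x.W y.W,
    μ.hom.ker = x.C ⊓ AddSubgroup.torsionBy x.W.Point (d : ℤ) ∧
    y.C = (AddSubgroup.torsionBy x.W.Point (d : ℤ) ⊔ x.C).map μ.hom

/-- The Galois conjugate `(E^τ, C^τ)` of `(E, C)`. -/
noncomputable def conj (τ : QBar ≃ₐ[ℚ] QBar) (x : Enhanced n) : Enhanced n where
  W := x.W.map ((τ : QBar ≃+* QBar) : QBar →+* QBar)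
  isElliptic := inferInstance
  C := x.C.map (conjPoint (τ : QBar ≃+* QBar) x.W).toAddMonoidHom
  isAddCyclic := isAddCyclic_of_surjective
    ((conjPoint (τ : QBar ≃+* QBar) x.W).addSubgroupMap x.C)
    ((conjPoint (τ : QBar ≃+* QBar) x.W).addSubgroupMap x.C).surjective
  card_eq := (Nat.card_congr
    ((conjPoint (τ : QBar ≃+* QBar) x.W).addSubgroupMap x.C).toEquiv).symm.trans x.card_eq

lemma Iso.conj (τ : QBar ≃ₐ[ℚ] QBar) {x y : Enhanced n} (h : x.Iso y) :
    (x.conj τ).Iso (y.conj τ) := by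
  obtain ⟨φ, ψ, h₁, h₂, hC⟩ := h
  refine ⟨φ.conj (τ : QBar ≃+* QBar), ψ.conj (τ : QBar ≃+* QBar), fun P => ?_, fun Q => ?_, ?_⟩
  · obtain ⟨P, rfl⟩ := (conjPoint (τ : QBar ≃+* QBar) x.W).surjective P
    exact ((congrArg _ (φ.conj_conjPoint _ P)).trans (ψ.conj_conjPoint _ _)).trans
      (congrArg _ (h₁ P))
  · obtain ⟨Q, rfl⟩ := (conjPoint (τ : QBar ≃+* QBar) y.W).surjective Q
    exact ((congrArg _ (ψ.conj_conjPoint _ Q)).trans (φ.conj_conjPoint _ _)).trans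
      (congrArg _ (h₂ Q))
  · exact (map_conj _ φ x.C).trans (congrArg _ hC)

lemma IsAtkinLehner.conj (τ : QBar ≃ₐ[ℚ] QBar) {d : ℕ} {x y : Enhanced n}
    (h : x.IsAtkinLehner d y) : (x.conj τ).IsAtkinLehner d (y.conj τ) := by
  obtain ⟨μ, hk, hC⟩ := h
  refine ⟨μ.conj (τ : QBar ≃+* QBar), ?_, ?_⟩
  · exact (map_ker_conj _ μ).trans
      ((congrArg (AddSubgroup.map _) hk).trans (map_inf_conj _ x.W x.C d))
  · exact (congrArg (AddSubgroup.map _) hC).trans ((map_conj _ μ _).symm.trans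
      (congrArg (AddSubgroup.map _) (map_sup_conj _ x.W x.C d)))

end Enhanced

/-- The `QBar`-points of the modular curve `Y_0(n)`, the complement of the cusps in `X_0(n)`:
isomorphism classes of pairs `(E, C)`. -/
def Y0 (n : ℕ) : Type := Quot (Enhanced.Iso (n := n))

namespace Y0

variable {n : ℕ}

/-- The action of a Galois automorphism on the `QBar`-points of `Y_0(n)`. -/
noncomputable def conj (τ : QBar ≃ₐ[ℚ] QBar) : Y0 n → Y0 n :=
  Quot.map (Enhanced.conj τ) fun _ _ h => h.conj τ

/-- The graph of the involution `w_d` of `Y_0(n)`. -/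
def AtkinLehnerRel (d : ℕ) (p q : Y0 n) : Prop :=
  ∃ x y : Enhanced n, Quot.mk _ x = p ∧ Quot.mk _ y = q ∧ x.IsAtkinLehner d y

lemma AtkinLehnerRel.conj (τ : QBar ≃ₐ[ℚ] QBar) {d : ℕ} {p q : Y0 n}
    (h : AtkinLehnerRel d p q) : AtkinLehnerRel d (p.conj τ) (q.conj τ) := by
  obtain ⟨x, y, rfl, rfl, h⟩ := h
  exact ⟨x.conj τ, y.conj τ, rfl, rfl, h.conj τ⟩

end Y0

/-- The `QBar`-points of the quotient `Y_0(n) / w_d`, i.e. the noncuspidal `QBar`-points of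
`X_0(n) / w_d`, for `n = d * m` with `d`, `m` coprime. -/
def Y0ModW (n d : ℕ) : Type := Quot (Y0.AtkinLehnerRel (n := n) d)

namespace Y0ModW

variable {n d : ℕ}

/-- The action of a Galois automorphism on the `QBar`-points of `Y_0(n) / w_d`. -/
noncomputable def conj (τ : QBar ≃ₐ[ℚ] QBar) : Y0ModW n d → Y0ModW n d :=
  Quot.map (Y0.conj τ) fun _ _ h => h.conj τ

/-- A noncuspidal point of `X_0(n) / w_d` is rational (over `ℚ`) if it is Galois invariant. -/
def IsRational (z : Y0ModW n d) : Prop := ∀ τ : QBar ≃ₐ[ℚ] QBar, z.conj τ = z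

/-- The class of the pair `x` in `Y_0(n) / w_d`. -/
def mk (d : ℕ) (x : Enhanced n) : Y0ModW n d := Quot.mk _ (Quot.mk _ x)

end Y0ModW

/-- The elliptic curve `F` over the number field `K` corresponds to a rational point of
`X_0(n) / w_d`: there is a rational noncuspidal point `{(E, C), w_d(E, C)}` of `X_0(n) / w_d` such
that `F` has the same `j`-invariant as the underlying curve of one of these pairs. -/
def CorrespondsToRationalPoint {K : IntermediateField ℚ QBar} (F : WeierstrassCurve K)
    [F.IsElliptic] (n d : ℕ) : Prop :=
  ∃ x : Enhanced n, (Y0ModW.mk d x).IsRational ∧ x.W.j = algebraMap K QBar F.j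

/-- The elliptic curve `F` over the number field `K` corresponds to a rational point of
`X_0^+(n) = X_0(n) / w_n`. -/
def CorrespondsToRationalPointPlus {K : IntermediateField ℚ QBar} (F : WeierstrassCurve K)
    [F.IsElliptic] (n : ℕ) : Prop :=
  CorrespondsToRationalPoint F n n

end EllCurve

/-!
Let `μ : E → E^σ` be a cyclic isogeny of degree `d`, and write `φ^σ : E^σ → E₁^σ` for the conjugate
of `φ : E → E₁`.

As `E` has no complex multiplication, all isogenies `E → E^σ` of degree `d` are `±μ`. Hence an
automorphism `τ` of `QBar` that fixes `K` takes `μ` to `±μ`, and one that induces `σ` takes `μ` to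
an isogeny `E^σ → E` whose composite with `μ` is multiplication by `±d`, so that it is the dual of
`μ` up to sign (`eq_or_eq_neg_of_card_ker_eq`, `comp_eq_or_eq_neg`). Let `B` be the subgroup
`ker φ ∩ μ⁻¹(ker φ^σ)` of `ker φ`, let `b` be its order, and `k = m / b`.

* The group `C = ker μ + B` is cyclic of order `b * d`. Since `ker φ` and `ker φ^σ` are cyclic,
  `B` and `μ(B)` are the subgroups of order `b` in them, so that they are conjugate. It follows that
  `τ` either fixes `(E, C)` or takes it to `(E^σ, μ(E[d] + C)) = w_d(E, C)`, and `(E, C)` gives a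
  rational point of `X_0((m / k) * d) / w_d` (`isRational_sup`).
* The isogeny `k φ^σ μ` kills `ker φ`, so it is `ν φ` for an isogeny `ν : E₁ → E₁^σ`, of degree
  `k ^ 2 * d`. Its kernel is cyclic, because otherwise it would contain `E₁[p]` for a prime `p`, and
  then `B` would have more than `b` elements, or `ker μ` or `ker φ^σ` would not be cyclic
  (`exists_cyclic_factor`). The conjugates of `ν` are `±ν` or dual to `ν` up to sign, since the same
  is true for `μ`, and so `(E₁, ker ν)` gives a rational point of `X_0^+(k ^ 2 * d)`
  (`isRational_of_isAddCyclic_ker`).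

What this needs about isogenies is proved on points. An isogeny is a homomorphism of the groups of
points with finite kernel along which coordinates pull back to rational functions (`IsRatHom`).
Functions on the curve that are invariant under `P ↦ -P` are rational functions of `x`, so that an
isogeny `f` acts on `x`-coordinates by a quotient `A / B` of coprime polynomials, and the order of
its kernel is the degree of `A / B` (`IsRatHom.card_ker_eq`). If another isogeny `g` kills `ker f`,
then `x(g P)` depends only on `x(f P)`; a rational function that is constant on the fibres of
`A / B` is a rational function of `A / B` (`exists_ratio_comp`), whence `g` factors through `f`
(`IsRatHom.exists_factor`). The degree `n ^ 2` of multiplication by `n` is found by induction from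
the formulas for the sum and the product of `x(P + Q)` and `x(P - Q)` (`ActsOnX.step`,
`card_ker_nsmul`).
-/

namespace EllCurve

open WeierstrassCurve Filter

/-! ### Coordinates of points -/

section Coordinates

variable {L : Type*} [Field L] {W : Affine L}

/-- The `x`-coordinate of a point, with the convention that it is `0` at the origin. -/
def xc : W.Point → L
  | .zero => 0
  | .some x _ _ => x

/-- The `y`-coordinate of a point, with the convention that it is `0` at the origin. -/
def yc : W.Point → L
  | .zero => 0
  | .some _ y _ => y

@[simp] lemma xc_some {x y : L} (h : W.Nonsingular x y) : xc (.some x y h : W.Point) = x := rfl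

@[simp] lemma yc_some {x y : L} (h : W.Nonsingular x y) : yc (.some x y h : W.Point) = y := rfl

@[simp] lemma xc_neg (P : W.Point) : xc (-P) = xc P := by
  rcases P with _ | ⟨x, y, h⟩ <;> rfl

lemma yc_neg {P : W.Point} (hP : P ≠ 0) : yc (-P) = -yc P - W.a₁ * xc P - W.a₃ := by
  rcases P with _ | ⟨x, y, h⟩
  · exact absurd rfl hP
  · rfl

lemma exists_some_of_ne_zero {P : W.Point} (hP : P ≠ 0) :
    ∃ h : W.Nonsingular (xc P) (yc P), P = .some (xc P) (yc P) h := by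
  rcases P with _ | ⟨x, y, h⟩
  · exact absurd rfl hP
  · exact ⟨h, rfl⟩

lemma equation_xc_yc {P : W.Point} (hP : P ≠ 0) : W.Equation (xc P) (yc P) :=
  (exists_some_of_ne_zero hP).1.1

lemma ext_coords {P Q : W.Point} (hP : P ≠ 0) (hQ : Q ≠ 0) (hx : xc P = xc Q)
    (hy : yc P = yc Q) : P = Q := by
  rcases P with _ | ⟨x, y, h⟩
  · exact absurd rfl hP
  rcases Q with _ | ⟨x', y', h'⟩
  · exact absurd rfl hQ
  obtain rfl : x = x' := hx
  obtain rfl : y = y' := hy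
  rfl

lemma eq_or_eq_neg_of_xc_eq [DecidableEq L] {P Q : W.Point} (hP : P ≠ 0) (hQ : Q ≠ 0)
    (h : xc P = xc Q) : P = Q ∨ P = -Q := by
  rcases P with _ | ⟨x, y, hP'⟩
  · exact absurd rfl hP
  rcases Q with _ | ⟨x', y', hQ'⟩
  · exact absurd rfl hQ
  exact Affine.Point.X_eq_iff.mp h

/-- The value at a point of a polynomial in the coordinates. -/
noncomputable def ev (p : L[X][Y]) (P : W.Point) : L := aevalAeval (xc P) (yc P) p

@[simp] lemma ev_add (p q : L[X][Y]) (P : W.Point) : ev (p + q) P = ev p P + ev q P :=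
  map_add _ _ _

@[simp] lemma ev_mul (p q : L[X][Y]) (P : W.Point) : ev (p * q) P = ev p P * ev q P :=
  map_mul _ _ _

@[simp] lemma ev_C (p : L[X]) (P : W.Point) : ev (C p) P = p.eval (xc P) := by
  rw [ev, aevalAeval_C]; rfl

@[simp] lemma ev_Y (P : W.Point) : ev Y P = yc P := aevalAeval_Y _ _

@[simp] lemma ev_one (P : W.Point) : ev (1 : L[X][Y]) P = 1 := map_one _

lemma neg_eventually {p : W.Point → Prop} (h : ∀ᶠ P in cofinite, p P) :
    ∀ᶠ P in cofinite, p (-P) :=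
  (neg_injective.tendsto_cofinite).eventually h

lemma exists_xc_eq [IsAlgClosed L] [W.IsElliptic] (x : L) : ∃ P : W.Point, P ≠ 0 ∧ xc P = x := by
  obtain ⟨y, hy⟩ := IsAlgClosed.exists_root
    (X ^ 2 + C (W.a₁ * x + W.a₃) * X - C (x ^ 3 + W.a₂ * x ^ 2 + W.a₄ * x + W.a₆) : L[X]) (by
      have : (X ^ 2 + C (W.a₁ * x + W.a₃) * X
        - C (x ^ 3 + W.a₂ * x ^ 2 + W.a₄ * x + W.a₆) : L[X]).degree = 2 := by
        compute_degree!
      rw [this]; norm_num)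
  have he : W.Equation x y := by
    rw [Affine.equation_iff]
    simp only [IsRoot, eval_sub, eval_add, eval_mul, eval_pow, eval_X, eval_C] at hy
    linear_combination hy
  exact ⟨.some x y (Affine.equation_iff_nonsingular.mp he), Affine.Point.some_ne_zero _, rfl⟩

lemma infinite_point [IsAlgClosed L] [W.IsElliptic] : Infinite W.Point := by
  have : Infinite L := IsAlgClosed.instInfinite
  exact Infinite.of_surjective (xc : W.Point → L) fun x => (exists_xc_eq x).imp fun _ h => h.2

lemma cofinite_neBot [IsAlgClosed L] [W.IsElliptic] : (cofinite : Filter W.Point).NeBot := by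
  have := infinite_point (W := W)
  infer_instance

section Cofinite

variable [DecidableEq L]

lemma finite_xc_eq (a : L) : {P : W.Point | xc P = a}.Finite := by
  by_cases h : ∃ Q : W.Point, Q ≠ 0 ∧ xc Q = a
  · obtain ⟨Q, hQ, rfl⟩ := h
    refine (Set.toFinite {0, Q, -Q}).subset fun P hP => ?_
    by_cases hP0 : P = 0
    · exact Or.inl hP0
    · exact Or.inr (eq_or_eq_neg_of_xc_eq hP0 hQ hP)
  · refine (Set.finite_singleton (0 : W.Point)).subset fun P hP => ?_
    by_contra hP0
    exact h ⟨P, hP0, hP⟩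

lemma tendsto_cofinite_of_finite_fibers {α β : Type*} {f : α → β}
    (h : ∀ b, {a | f a = b}.Finite) : Tendsto f cofinite cofinite :=
  Tendsto.cofinite_of_finite_preimage_singleton h

lemma tendsto_xc : Tendsto (xc : W.Point → L) cofinite cofinite :=
  tendsto_cofinite_of_finite_fibers finite_xc_eq

lemma eventually_ne_cofinite {α : Type*} (a : α) : ∀ᶠ x in cofinite, x ≠ a := by
  rw [eventually_cofinite]
  simp

lemma eventually_eval_ne_zero {p : L[X]} (hp : p ≠ 0) :
    ∀ᶠ x in (cofinite : Filter L), p.eval x ≠ 0 := by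
  rw [eventually_cofinite]
  simpa using (p.rootSet_finite L).subset fun x hx => by
    simpa [mem_rootSet, hp] using hx

lemma eventually_eval_xc_ne_zero {p : L[X]} (hp : p ≠ 0) :
    ∀ᶠ P in (cofinite : Filter W.Point), p.eval (xc P) ≠ 0 :=
  tendsto_xc.eventually (eventually_eval_ne_zero hp)

section

variable [IsAlgClosed L] [W.IsElliptic]

lemma eq_of_eventually_eval_xc_eq {p q : L[X]}
    (h : ∀ᶠ P in (cofinite : Filter W.Point), p.eval (xc P) = q.eval (xc P)) : p = q := by
  by_contra hpq
  have := cofinite_neBot (W := W)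
  obtain ⟨P, hP, hP'⟩ := (h.and (eventually_eval_xc_ne_zero (sub_ne_zero.mpr hpq))).exists
  exact hP' (by rw [eval_sub, hP, sub_self])

/-- Two homomorphisms from a group of points agreeing outside a finite set are equal: the set where
they agree is a subgroup with finite complement in an infinite group. -/
lemma hom_eq_of_eventually_eq {G : Type*} [AddGroup G] {f g : W.Point →+ G}
    (h : ∀ᶠ P in cofinite, f P = g P) : f = g := by
  have := cofinite_neBot (W := W)
  ext Q
  obtain ⟨P, hP, hP'⟩ := (h.and (((add_left_injective Q).tendsto_cofinite).eventually h)).exists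
  have : f P + f Q = g P + g Q := by rw [← map_add, ← map_add]; exact hP'
  rw [hP] at this
  exact add_left_cancel this

end

end Cofinite

lemma xc_add [DecidableEq L] {P Q : W.Point} (hP : P ≠ 0) (hQ : Q ≠ 0) (h : xc P ≠ xc Q) :
    xc (P + Q) = ((yc P - yc Q) / (xc P - xc Q)) ^ 2 + W.a₁ * ((yc P - yc Q) / (xc P - xc Q))
      - W.a₂ - xc P - xc Q := by
  rcases P with _ | ⟨x, y, hP'⟩
  · exact absurd rfl hP
  rcases Q with _ | ⟨x', y', hQ'⟩
  · exact absurd rfl hQ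
  change x ≠ x' at h
  rw [Affine.Point.add_of_X_ne h, xc_some, Affine.slope_of_X_ne h]
  rfl

lemma yc_add [DecidableEq L] {P Q : W.Point} (hP : P ≠ 0) (hQ : Q ≠ 0) (h : xc P ≠ xc Q) :
    yc (P + Q) = -(((yc P - yc Q) / (xc P - xc Q)) * (xc (P + Q) - xc P) + yc P)
      - W.a₁ * xc (P + Q) - W.a₃ := by
  rcases P with _ | ⟨x, y, hP'⟩
  · exact absurd rfl hP
  rcases Q with _ | ⟨x', y', hQ'⟩
  · exact absurd rfl hQ
  change x ≠ x' at h
  rw [Affine.Point.add_of_X_ne h]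
  simp only [xc_some, yc_some, Affine.slope_of_X_ne h]
  rfl

lemma add_ne_zero_of_xc_ne [DecidableEq L] {P Q : W.Point} (h : xc P ≠ xc Q) : P + Q ≠ 0 := by
  intro h0
  apply h
  rw [eq_neg_of_add_eq_zero_left h0, xc_neg]

end Coordinates

/-! ### Rational functions on the curve -/

section RationalFunctions

variable {L : Type*} [Field L] {W : Affine L}

/-- A function on the points of `W` is rational if it agrees, outside a finite set, with a quotient
of polynomials in the coordinates whose denominator does not vanish there. -/
def IsRat (u : W.Point → L) : Prop :=
  ∃ f h : L[X][Y], ∀ᶠ P in cofinite, ev h P ≠ 0 ∧ u P = ev f P / ev h P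

namespace IsRat

variable {u v : W.Point → L}

lemma congr (hu : IsRat u) (h : ∀ᶠ P in cofinite, v P = u P) : IsRat v := by
  obtain ⟨f, g, hfg⟩ := hu
  exact ⟨f, g, by filter_upwards [hfg, h] with P h₁ h₂ using ⟨h₁.1, h₂.trans h₁.2⟩⟩

lemma const (c : L) : IsRat (fun _ : W.Point => c) :=
  ⟨C (C c), 1, Eventually.of_forall fun P => by simp⟩

lemma xCoord : IsRat (xc : W.Point → L) :=
  ⟨C X, 1, Eventually.of_forall fun P => by simp⟩

lemma yCoord : IsRat (yc : W.Point → L) :=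
  ⟨Y, 1, Eventually.of_forall fun P => by simp⟩

lemma add (hu : IsRat u) (hv : IsRat v) : IsRat (fun P => u P + v P) := by
  obtain ⟨f, g, hu⟩ := hu
  obtain ⟨f', g', hv⟩ := hv
  refine ⟨f * g' + g * f', g * g', ?_⟩
  filter_upwards [hu, hv] with P h₁ h₂
  simp only [ev_mul, ev_add]
  exact ⟨mul_ne_zero h₁.1 h₂.1, by rw [h₁.2, h₂.2, div_add_div _ _ h₁.1 h₂.1]⟩

lemma mul (hu : IsRat u) (hv : IsRat v) : IsRat (fun P => u P * v P) := by
  obtain ⟨f, g, hu⟩ := hu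
  obtain ⟨f', g', hv⟩ := hv
  refine ⟨f * f', g * g', ?_⟩
  filter_upwards [hu, hv] with P h₁ h₂
  simp only [ev_mul]
  exact ⟨mul_ne_zero h₁.1 h₂.1, by rw [h₁.2, h₂.2, div_mul_div_comm]⟩

lemma neg (hu : IsRat u) : IsRat (fun P => -u P) := by
  simpa using (const (W := W) (-1)).mul hu

lemma sub (hu : IsRat u) (hv : IsRat v) : IsRat (fun P => u P - v P) := by
  simpa [sub_eq_add_neg] using hu.add hv.neg

lemma div (hu : IsRat u) (hv : IsRat v) (h0 : ∀ᶠ P in cofinite, v P ≠ 0) :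
    IsRat (fun P => u P / v P) := by
  obtain ⟨f, g, hu⟩ := hu
  obtain ⟨f', g', hv⟩ := hv
  refine ⟨f * g', g * f', ?_⟩
  filter_upwards [hu, hv, h0] with P h₁ h₂ h₃
  have h₄ : ev f' P ≠ 0 := fun h => h₃ (by rw [h₂.2, h, zero_div])
  have h₅ := h₁.1
  have h₆ := h₂.1
  simp only [ev_mul]
  refine ⟨mul_ne_zero h₅ h₄, ?_⟩
  rw [h₁.2, h₂.2]
  field_simp

lemma eval_comp (hu : IsRat u) (p : L[X]) : IsRat (fun P => p.eval (u P)) := by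
  induction p using Polynomial.induction_on' with
  | add p q hp hq => simpa using hp.add hq
  | monomial n a =>
    simp only [eval_monomial]
    refine (const a).mul ?_
    induction n with
    | zero => simpa using const (W := W) 1
    | succ n ih => simpa [pow_succ] using ih.mul hu

lemma aevalAeval_comp (hu : IsRat u) (hv : IsRat v) (p : L[X][Y]) :
    IsRat (fun P => aevalAeval (u P) (v P) p) := by
  induction p using Polynomial.induction_on' with
  | add p q hp hq => simpa only [map_add] using hp.add hq
  | monomial n a =>
    simp only [← C_mul_X_pow_eq_monomial, map_mul, map_pow, aevalAeval_C, aevalAeval_Y]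
    refine IsRat.mul (hu.eval_comp a) ?_
    induction n with
    | zero => simpa using const (W := W) 1
    | succ n ih => simpa [pow_succ] using ih.mul hv

end IsRat

end RationalFunctions

lemma aevalAeval_map_algebraMap {L : Type*} [Field L] {k : Type*} [Field k] [Algebra k L]
    (x y : L) (p : k[X][Y]) :
    aevalAeval x y (p.map (mapRingHom (algebraMap k L))) = aevalAeval x y p := by
  induction p using Polynomial.induction_on' with
  | add p q hp hq => simp only [Polynomial.map_add, map_add, hp, hq]
  | monomial n a =>
    simp only [← C_mul_X_pow_eq_monomial, Polynomial.map_mul, Polynomial.map_pow, map_C, map_X,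
      map_mul, map_pow, aevalAeval_C, aevalAeval_Y, coe_mapRingHom, aeval_map_algebraMap]

/-! ### Rational homomorphisms -/

section RationalHoms

variable {L : Type*} [Field L] [DecidableEq L] {W W₁ W₂ W₃ : Affine L}

/-- A homomorphism between groups of points is rational if it has finite kernel and its coordinates
are rational functions. These are exactly the maps on points underlying isogenies over `L`. -/
structure IsRatHom (f : W₁.Point →+ W₂.Point) : Prop where
  x : IsRat fun P => xc (f P)
  y : IsRat fun P => yc (f P)
  finite_ker : (f.ker : Set W₁.Point).Finite

lemma finite_fibers_of_finite_ker {G H : Type*} [AddGroup G] [AddGroup H] {f : G →+ H}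
    (hf : (f.ker : Set G).Finite) (b : H) : {a | f a = b}.Finite := by
  by_cases h : ∃ a, f a = b
  · obtain ⟨a, rfl⟩ := h
    refine (hf.image (fun c => a + c)).subset fun c hc => ⟨-a + c, ?_, by simp⟩
    have : f c = f a := hc
    simp [AddMonoidHom.mem_ker, this]
  · convert Set.finite_empty
    exact Set.eq_empty_of_forall_notMem fun a ha => h ⟨a, ha⟩

namespace IsRatHom

variable {f : W₁.Point →+ W₂.Point}

lemma tendsto (hf : IsRatHom f) : Tendsto f cofinite cofinite :=
  tendsto_cofinite_of_finite_fibers (finite_fibers_of_finite_ker hf.finite_ker)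

lemma eventually_ne_zero (hf : IsRatHom f) : ∀ᶠ P in cofinite, f P ≠ 0 :=
  hf.tendsto.eventually (eventually_ne_cofinite 0)

lemma isRat_comp (hf : IsRatHom f) {u : W₂.Point → L} (hu : IsRat u) :
    IsRat (fun P => u (f P)) := by
  obtain ⟨p, q, hpq⟩ := hu
  have h := hf.tendsto.eventually hpq
  refine ((hf.x.aevalAeval_comp hf.y p).div (hf.x.aevalAeval_comp hf.y q) ?_).congr ?_
  · filter_upwards [h] with P hP using hP.1
  · filter_upwards [h] with P hP using hP.2

lemma comp {g : W₂.Point →+ W₃.Point} (hg : IsRatHom g) (hf : IsRatHom f) :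
    IsRatHom (g.comp f) where
  x := hf.isRat_comp hg.x
  y := hf.isRat_comp hg.y
  finite_ker := by
    refine (hg.finite_ker.biUnion fun b _ =>
      finite_fibers_of_finite_ker hf.finite_ker b).subset fun a ha => ?_
    simp only [Set.mem_iUnion]
    exact ⟨f a, ha, rfl⟩

lemma id : IsRatHom (AddMonoidHom.id W.Point) where
  x := IsRat.xCoord
  y := IsRat.yCoord
  finite_ker := by
    refine (Set.finite_singleton (0 : W.Point)).subset fun a ha => ?_
    simpa using ha

/-- Sums of rational homomorphisms are rational, provided that the generic point has distinct
`x`-coordinates under the two, so that the chord formula applies. -/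
lemma add {g : W₁.Point →+ W₂.Point} (hf : IsRatHom f) (hg : IsRatHom g)
    (hx : ∀ᶠ P in cofinite, xc (f P) ≠ xc (g P)) : IsRatHom (f + g) := by
  have hne : ∀ᶠ P in cofinite, xc (f P) - xc (g P) ≠ 0 := by
    filter_upwards [hx] with P hP using sub_ne_zero.mpr hP
  have hs := (hf.y.sub hg.y).div (hf.x.sub hg.x) hne
  have hxr : IsRat fun P => xc ((f + g) P) := by
    refine (((hs.mul hs).add ((IsRat.const W₂.a₁).mul hs)).sub
      ((IsRat.const W₂.a₂).add (hf.x.add hg.x))).congr ?_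
    filter_upwards [hx, hf.eventually_ne_zero, hg.eventually_ne_zero] with P h₁ h₂ h₃
    rw [AddMonoidHom.add_apply, xc_add h₂ h₃ h₁]
    ring
  refine ⟨hxr, ?_, ?_⟩
  · refine ((((hs.mul (hxr.sub hf.x)).add hf.y).neg.sub
      ((IsRat.const W₂.a₁).mul hxr)).sub (IsRat.const W₂.a₃)).congr ?_
    filter_upwards [hx, hf.eventually_ne_zero, hg.eventually_ne_zero] with P h₁ h₂ h₃
    rw [AddMonoidHom.add_apply, yc_add h₂ h₃ h₁]
  · refine (eventually_cofinite.mp hx).subset fun P hP => ?_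
    exact fun h => add_ne_zero_of_xc_ne h hP

end IsRatHom

lemma Isogeny.eventually_rational {k : Type*} [Field k] [Algebra k L] (φ : Isogeny k W₁ W₂) :
    ∃ f g h : k[X][Y], ∀ᶠ P in (cofinite : Filter W₁.Point),
      aevalAeval (xc P) (yc P) h ≠ 0 ∧ φ.hom P ≠ 0 ∧
      xc (φ.hom P) = aevalAeval (xc P) (yc P) f / aevalAeval (xc P) (yc P) h ∧
      yc (φ.hom P) = aevalAeval (xc P) (yc P) g / aevalAeval (xc P) (yc P) h := by
  obtain ⟨f, g, h, hfin, hφ⟩ := φ.rational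
  have hh : ∀ᶠ P in (cofinite : Filter W₁.Point), aevalAeval (xc P) (yc P) h ≠ 0 := by
    rw [eventually_cofinite]
    refine ((Set.finite_singleton 0).union (Set.Finite.of_finite_image
      (f := fun P : W₁.Point => (xc P, yc P)) (s := {P | P ≠ 0 ∧ aevalAeval (xc P) (yc P) h = 0})
      (hfin.subset ?_) ?_)).subset ?_
    · rintro _ ⟨P, ⟨hP, hP'⟩, rfl⟩
      exact ⟨equation_xc_yc hP, hP'⟩
    · rintro P ⟨hP, -⟩ Q ⟨hQ, -⟩ hPQ
      exact ext_coords hP hQ (Prod.mk.inj hPQ).1 (Prod.mk.inj hPQ).2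
    · intro P hP
      by_cases hP0 : P = 0
      · exact Or.inl hP0
      · exact Or.inr ⟨hP0, not_not.mp hP⟩
  refine ⟨f, g, h, ?_⟩
  filter_upwards [hh, eventually_ne_cofinite 0] with P hP hP0
  obtain ⟨hns, hP'⟩ := exists_some_of_ne_zero hP0
  obtain ⟨hns', e⟩ := hφ _ _ hns hP
  rw [← hP'] at e
  rw [e]
  exact ⟨hP, Affine.Point.some_ne_zero _, rfl, rfl⟩

lemma Isogeny.isRatHom {k : Type*} [Field k] [Algebra k L] (φ : Isogeny k W₁ W₂) :
    IsRatHom φ.hom := by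
  obtain ⟨f, g, h, hfgh⟩ := φ.eventually_rational
  refine ⟨⟨f.map (mapRingHom (algebraMap k L)), h.map (mapRingHom (algebraMap k L)), ?_⟩,
    ⟨g.map (mapRingHom (algebraMap k L)), h.map (mapRingHom (algebraMap k L)), ?_⟩,
    (eventually_cofinite.mp hfgh).subset fun P hP h => h.2.1 hP⟩
  all_goals
    filter_upwards [hfgh] with P hP
    simp only [ev, aevalAeval_map_algebraMap]
  exacts [⟨hP.1, hP.2.2.1⟩, ⟨hP.1, hP.2.2.2⟩]

/-- Every rational homomorphism underlies an isogeny: multiply the common denominator by a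
polynomial in `x` that vanishes at the finitely many points where the formulas fail. -/
lemma IsRatHom.exists_isogeny [W₁.IsElliptic] {f : W₁.Point →+ W₂.Point} (hf : IsRatHom f) :
    ∃ φ : Isogeny L W₁ W₂, φ.hom = f := by
  obtain ⟨p, q, hpq⟩ := hf.x
  obtain ⟨p', q', hpq'⟩ := hf.y
  have hgood := (hpq.and hpq').and hf.eventually_ne_zero
  set Z := (eventually_cofinite.mp hgood).toFinset with hZ
  have hmem : ∀ P, P ∉ Z → (((ev q P ≠ 0 ∧ xc (f P) = ev p P / ev q P) ∧
      (ev q' P ≠ 0 ∧ yc (f P) = ev p' P / ev q' P)) ∧ f P ≠ 0) := fun P hP => by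
    by_contra h
    exact hP (by rw [hZ, Set.Finite.mem_toFinset]; exact h)
  set r : L[X] := ∏ P ∈ Z, (X - C (xc P)) with hr
  have hr0 : r ≠ 0 := Finset.prod_ne_zero_iff.mpr fun P _ => X_sub_C_ne_zero _
  have hrZ : ∀ P ∈ Z, r.eval (xc P) = 0 := fun P hP => by
    rw [hr, eval_prod]
    exact Finset.prod_eq_zero hP (by simp)
  refine ⟨⟨f, C r * p * q', C r * q * p', C r * q * q', ?_, ?_⟩, rfl⟩
  · have : ∀ᶠ P in (cofinite : Filter W₁.Point), ev (C r * q * q') P ≠ 0 := by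
      filter_upwards [hgood, eventually_eval_xc_ne_zero hr0] with P h₁ h₂
      simp only [ev_mul, ev_C]
      exact mul_ne_zero (mul_ne_zero h₂ h₁.1.1.1) h₁.1.2.1
    refine ((eventually_cofinite.mp this).image fun P => (xc P, yc P)).subset ?_
    rintro ⟨x, y⟩ ⟨h₁, h₂⟩
    exact ⟨.some x y (Affine.equation_iff_nonsingular.mp h₁), not_not.mpr h₂, rfl⟩
  · intro x y hxy h0
    set P : W₁.Point := .some x y hxy with hP
    change ev (C r * q * q') P ≠ 0 at h0
    have h0' := h0
    simp only [ev_mul, ev_C] at h0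
    have hr1 : r.eval (xc P) ≠ 0 := fun h => h0 (by rw [h]; ring)
    have hPZ : P ∉ Z := fun h => hr1 (hrZ P h)
    obtain ⟨⟨⟨h₁, h₂⟩, h₃, h₄⟩, h₅⟩ := hmem P hPZ
    obtain ⟨hns, e⟩ := exists_some_of_ne_zero h₅
    have ex : xc (f P) = ev (C r * p * q') P / ev (C r * q * q') P := by
      rw [h₂]; simp only [ev_mul, ev_C]; field_simp
    have ey : yc (f P) = ev (C r * q * p') P / ev (C r * q * q') P := by
      rw [h₄]; simp only [ev_mul, ev_C]; field_simp
    change ∃ h' : W₂.Nonsingular (ev (C r * p * q') P / ev (C r * q * q') P)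
      (ev (C r * q * p') P / ev (C r * q * q') P), f P = .some _ _ h'
    rw [← ex, ← ey]
    exact ⟨hns, e⟩

end RationalHoms

/-! ### Rational maps of the line -/

section RationalMapsOfTheLine

variable {L : Type*} [Field L]

lemma exists_coprime_of_ne_zero [DecidableEq L] (A : L[X]) {B : L[X]} (hB : B ≠ 0) :
    ∃ g A' B' : L[X], IsCoprime A' B' ∧ g ≠ 0 ∧ B' ≠ 0 ∧ A = g * A' ∧ B = g * B' := by
  have hg : gcd A B ≠ 0 := fun h => hB ((gcd_eq_zero_iff _ _).mp h).2
  have h₁ := EuclideanDomain.mul_div_cancel' hg (gcd_dvd_left A B)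
  have h₂ := EuclideanDomain.mul_div_cancel' hg (gcd_dvd_right A B)
  refine ⟨gcd A B, A / gcd A B, B / gcd A B, isCoprime_div_gcd_div_gcd hB, hg, ?_, h₁.symm,
    h₂.symm⟩
  intro h
  rw [h, mul_zero] at h₂
  exact hB h₂.symm

lemma eval_ne_zero_of_isCoprime {A B : L[X]} (h : IsCoprime A B) {x : L} (hB : B.eval x = 0) :
    A.eval x ≠ 0 := by
  obtain ⟨a, b, hab⟩ := h
  intro hA
  simpa [hA, hB] using congrArg (Polynomial.eval x) hab

lemma eval_ne_zero_of_isCoprime_of_eval_eq {A B : L[X]} (h : IsCoprime A B) {x c : L}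
    (hx : A.eval x = c * B.eval x) : B.eval x ≠ 0 := fun hB =>
  eval_ne_zero_of_isCoprime h hB (by rw [hx, hB, mul_zero])

/-- The Wronskian of a coprime pair, not both constant, does not vanish in characteristic zero. -/
lemma wronskian_ne_zero_of_isCoprime [CharZero L] {A B : L[X]} (h : IsCoprime A B)
    (hr : 0 < max A.natDegree B.natDegree) :
    derivative A * B - A * derivative B ≠ 0 := by
  intro hw
  have hw' : derivative A * B = A * derivative B := sub_eq_zero.mp hw
  have key : ∀ {p q : L[X]}, IsCoprime p q → derivative p * q = p * derivative q →
      p.natDegree = 0 := by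
    intro p q hpq he
    have hd : p ∣ derivative p := hpq.dvd_of_dvd_mul_right (Dvd.intro _ he.symm)
    by_contra hp
    have h0 : derivative p = 0 := by
      by_contra h0
      have := natDegree_le_of_dvd hd h0
      have := natDegree_derivative_lt hp
      omega
    exact hp (derivative_eq_zero.mp h0)
  have h₁ := key h hw'
  have h₂ := key h.symm (by rw [mul_comm, ← hw', mul_comm])
  omega

/-- A rational function `A / B` of degree `r` takes almost every value exactly `r` times. -/
lemma eventually_card_roots [DecidableEq L] [IsAlgClosed L] [CharZero L] {A B : L[X]}
    (h : IsCoprime A B) {r : ℕ} (hr : max A.natDegree B.natDegree = r) (hr0 : 0 < r) :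
    ∀ᶠ c in cofinite, (A - C c * B).roots.toFinset.card = r ∧ A - C c * B ≠ 0 := by
  -- Values `c` at which the degree of `A - c B` drops, and the critical values, are excluded.
  have hlead : (C (A.coeff r) - C (B.coeff r) * X : L[X]) ≠ 0 := by
    intro h0
    have h₁ : A.coeff r = 0 := by simpa using congrArg (fun p => coeff p 0) h0
    have h₂ : B.coeff r = 0 := by simpa using congrArg (fun p => coeff p 1) h0
    rcases max_choice A.natDegree B.natDegree with hm | hm
    · have : A.natDegree = r := hm.symm.trans hr
      rw [← this, coeff_natDegree, leadingCoeff_eq_zero] at h₁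
      rw [h₁, natDegree_zero] at this
      omega
    · have : B.natDegree = r := hm.symm.trans hr
      rw [← this, coeff_natDegree, leadingCoeff_eq_zero] at h₂
      rw [h₂, natDegree_zero] at this
      omega
  have hw := wronskian_ne_zero_of_isCoprime h (by omega)
  set w := derivative A * B - A * derivative B with hwdef
  have hfin : ((fun x => A.eval x / B.eval x) '' (w.roots.toFinset : Set L)).Finite :=
    (Finset.finite_toSet _).image _
  filter_upwards [eventually_eval_ne_zero hlead, hfin.eventually_cofinite_notMem] with c hc hcw
  have hcoeff : (A - C c * B).coeff r ≠ 0 := by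
    rw [eval_sub, eval_mul, eval_C, eval_C, eval_X] at hc
    rwa [coeff_sub, coeff_C_mul, mul_comm c]
  have hne : A - C c * B ≠ 0 := fun h0 => hcoeff (by rw [h0, coeff_zero])
  have hdeg : (A - C c * B).natDegree = r := by
    refine le_antisymm ?_ (le_natDegree_of_ne_zero hcoeff)
    refine (natDegree_sub_le _ _).trans ?_
    have := natDegree_C_mul_le c B
    omega
  refine ⟨?_, hne⟩
  have hnodup : (A - C c * B).roots.Nodup := by
    rw [Multiset.nodup_iff_count_le_one]
    intro x
    rw [count_roots]
    by_contra! hx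
    rw [one_lt_rootMultiplicity_iff_isRoot hne] at hx
    obtain ⟨h₁, h₂⟩ := hx
    simp only [IsRoot, eval_sub, eval_mul, eval_C, derivative_sub, derivative_C_mul,
      sub_eq_zero] at h₁ h₂
    refine hcw ⟨x, ?_, ?_⟩
    · rw [Finset.mem_coe, Multiset.mem_toFinset, mem_roots hw, IsRoot, hwdef, eval_sub, eval_mul,
        eval_mul, h₁, h₂]
      ring
    · have := eval_ne_zero_of_isCoprime_of_eval_eq h h₁
      change A.eval x / B.eval x = c
      rw [h₁]
      field_simp
  rw [Multiset.toFinset_card_of_nodup hnodup, ← hdeg]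
  exact (IsAlgClosed.splits _).natDegree_eq_card_roots.symm

lemma tendsto_ratio [DecidableEq L] {A B : L[X]} (h : IsCoprime A B)
    (hr0 : 0 < max A.natDegree B.natDegree) :
    Tendsto (fun x => A.eval x / B.eval x) cofinite cofinite := by
  have hB : B ≠ 0 := by
    rintro rfl
    have := natDegree_eq_zero_of_isUnit (isCoprime_zero_right.mp h)
    simp [this] at hr0
  refine tendsto_cofinite_of_finite_fibers fun c => ?_
  have hne : A - C c * B ≠ 0 := by
    intro h0
    rw [sub_eq_zero] at h0
    have hu : IsUnit B := isCoprime_self.mp (by rw [h0] at h; exact h.of_mul_left_right)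
    have h₁ := natDegree_eq_zero_of_isUnit hu
    have h₂ := natDegree_C_mul_le c B
    rw [← h0] at h₂
    omega
  refine ((eventually_cofinite.mp
    ((eventually_eval_ne_zero hne).and (eventually_eval_ne_zero hB)))).subset fun x hx hx' => ?_
  apply hx'.1
  have := hx'.2
  have hx : A.eval x / B.eval x = c := hx
  rw [eval_sub, eval_mul, eval_C, ← hx]
  field_simp
  ring

/-- If the rational function `S / T` is constant on the fibres of the nonconstant rational function
`A / B`, then it is a rational function of `A / B`. For the proof let `s` bound the degrees of `S`
and `T`, and look for `U`, `V` of degree at most `s` with `U(A/B) * T = V(A/B) * S`. At all the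
points of one fibre this is a single linear condition, so there is a nonzero solution at the points
of `2 * s + 1` fibres; as these are more points than the degree allows, it is an identity. -/
lemma exists_ratio_comp [DecidableEq L] [IsAlgClosed L] [CharZero L] {A B S T : L[X]}
    (h : IsCoprime A B) (hr0 : 0 < max A.natDegree B.natDegree) (hT : T ≠ 0) {Z : Set L}
    (hZ : Z.Finite) (hS : ∀ x ∉ Z, ∀ x' ∉ Z, A.eval x / B.eval x = A.eval x' / B.eval x' →
      S.eval x / T.eval x = S.eval x' / T.eval x') :
    ∃ U V : L[X], V ≠ 0 ∧ ∀ᶠ x in cofinite,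
      S.eval x / T.eval x = U.eval (A.eval x / B.eval x) / V.eval (A.eval x / B.eval x) := by
  have hB : B ≠ 0 := by
    rintro rfl
    have := natDegree_eq_zero_of_isUnit (isCoprime_zero_right.mp h)
    simp [this] at hr0
  have : Infinite L := IsAlgClosed.instInfinite
  set r := max A.natDegree B.natDegree with hr
  set s := max S.natDegree T.natDegree with hs
  -- `t` consists of `2 * s + 1` values whose fibres have `r` elements and avoid the exceptions.
  set Z' : Set L := Z ∪ {x | ¬ T.eval x ≠ 0} with hZ'
  have hZ'fin : Z'.Finite := hZ.union (eventually_cofinite.mp (eventually_eval_ne_zero hT))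
  have hgood : ∀ᶠ c in cofinite, ((A - C c * B).roots.toFinset.card = r ∧ A - C c * B ≠ 0) ∧
      c ∉ (fun x => A.eval x / B.eval x) '' Z' :=
    (eventually_card_roots h rfl hr0).and (hZ'fin.image _).eventually_cofinite_notMem
  obtain ⟨t, ht, htcard⟩ := (eventually_cofinite.mp hgood).infinite_compl.exists_subset_card_eq
    (2 * s + 1)
  have ht' : ∀ c ∈ t, ((A - C c * B).roots.toFinset.card = r ∧ A - C c * B ≠ 0) ∧
      c ∉ (fun x => A.eval x / B.eval x) '' Z' := fun c hc => not_not.mp (ht hc)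
  have hroot : ∀ c ∈ t, ∀ x, x ∈ (A - C c * B).roots.toFinset ↔ A.eval x = c * B.eval x := by
    intro c hc x
    rw [Multiset.mem_toFinset, mem_roots (ht' c hc).1.2]
    simp [IsRoot, sub_eq_zero]
  have hratio : ∀ {x c}, A.eval x = c * B.eval x → A.eval x / B.eval x = c := by
    intro x c hx
    have := eval_ne_zero_of_isCoprime_of_eval_eq h hx
    rw [hx]
    field_simp
  have hnotZ : ∀ c ∈ t, ∀ x, A.eval x = c * B.eval x → x ∉ Z' := fun c hc x hx hxZ =>
    (ht' c hc).2 ⟨x, hxZ, hratio hx⟩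
  have hex : ∀ c : t, ∃ x, A.eval x = c * B.eval x := fun c => by
    have : (A - C (c : L) * B).roots.toFinset.Nonempty := by
      rw [← Finset.card_pos, (ht' c c.2).1.1]
      exact hr0
    exact this.imp fun x hx => (hroot c c.2 x).mp hx
  choose ξ hξ using hex
  -- The linear conditions on `(U, V)`, one for each value in `t`.
  let Λ : (degreeLT L (s + 1) × degreeLT L (s + 1)) →ₗ[L] (t → L) :=
    { toFun := fun p c => p.1.1.eval (c : L) * T.eval (ξ c) - p.2.1.eval (c : L) * S.eval (ξ c)
      map_add' := fun p q => by ext c; simp; ring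
      map_smul' := fun a p => by ext c; simp; ring }
  have := Module.Finite.equiv (degreeLTEquiv L (s + 1)).symm
  have hker : LinearMap.ker Λ ≠ ⊥ := LinearMap.ker_ne_bot_of_finrank_lt (by
    rw [Module.finrank_prod, (degreeLTEquiv L (s + 1)).finrank_eq]
    simp [htcard]
    omega)
  obtain ⟨⟨⟨U, hU⟩, ⟨V, hV⟩⟩, hUV, hUV0⟩ := Submodule.exists_mem_ne_zero_of_ne_bot hker
  have hUVc : ∀ c (hc : c ∈ t), ∀ x, A.eval x = c * B.eval x →
      U.eval c * T.eval x - V.eval c * S.eval x = 0 := by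
    intro c hc x hx
    have h₁ : U.eval c * T.eval (ξ ⟨c, hc⟩) - V.eval c * S.eval (ξ ⟨c, hc⟩) = 0 :=
      congrFun (LinearMap.mem_ker.mp hUV) ⟨c, hc⟩
    have hξc := hξ ⟨c, hc⟩
    have hx₁ := hnotZ c hc x hx
    have hx₂ := hnotZ c hc _ hξc
    have h₂ := hS x (fun hx => hx₁ (Or.inl hx)) _ (fun hx => hx₂ (Or.inl hx))
      ((hratio hx).trans (hratio hξc).symm)
    have h₃ : T.eval x ≠ 0 := not_not.mp fun hx => hx₁ (Or.inr hx)
    have h₄ : T.eval (ξ ⟨c, hc⟩) ≠ 0 := not_not.mp fun hx => hx₂ (Or.inr hx)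
    rw [div_eq_div_iff h₃ h₄] at h₂
    apply mul_left_cancel₀ h₄
    linear_combination T.eval x * h₁ - V.eval c * h₂
  have hUdeg : U.natDegree < s + 1 := Nat.lt_succ_of_le <|
    natDegree_le_iff_coeff_eq_zero.mpr fun i hi =>
      (degree_lt_iff_coeff_zero _ _).mp (mem_degreeLT.mp hU) i hi
  have hVdeg : V.natDegree < s + 1 := Nat.lt_succ_of_le <|
    natDegree_le_iff_coeff_eq_zero.mpr fun i hi =>
      (degree_lt_iff_coeff_zero _ _).mp (mem_degreeLT.mp hV) i hi
  -- `U(A/B) * T - V(A/B) * S`, multiplied by `B ^ s`.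
  set G : L[X] := ∑ i ∈ Finset.range (s + 1),
    (C (U.coeff i) * T - C (V.coeff i) * S) * A ^ i * B ^ (s - i) with hG
  have hGeval : ∀ x c, A.eval x = c * B.eval x →
      G.eval x = B.eval x ^ s * (U.eval c * T.eval x - V.eval c * S.eval x) := by
    intro x c hx
    rw [hG, eval_finsetSum, eval_eq_sum_range' hUdeg, eval_eq_sum_range' hVdeg, Finset.sum_mul,
      Finset.sum_mul, ← Finset.sum_sub_distrib, Finset.mul_sum]
    refine Finset.sum_congr rfl fun i hi => ?_
    have hi' : s = i + (s - i) := by have := Finset.mem_range.mp hi; omega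
    simp only [eval_mul, eval_sub, eval_C, eval_pow, hx]
    conv_rhs => rw [hi', pow_add]
    ring
  have hGdeg : G.natDegree ≤ s + r * s := by
    refine natDegree_sum_le_of_forall_le _ _ fun i hi => ?_
    have hi' : i ≤ s := by have := Finset.mem_range.mp hi; omega
    have h₁ : (C (U.coeff i) * T - C (V.coeff i) * S).natDegree ≤ s := by
      refine (natDegree_sub_le _ _).trans ?_
      have := natDegree_C_mul_le (U.coeff i) T
      have := natDegree_C_mul_le (V.coeff i) S
      omega
    have h₂ : (A ^ i).natDegree ≤ i * r := natDegree_pow_le.trans (Nat.mul_le_mul_left _ (by omega))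
    have h₃ : (B ^ (s - i)).natDegree ≤ (s - i) * r :=
      natDegree_pow_le.trans (Nat.mul_le_mul_left _ (by omega))
    have h₄ : i * r + (s - i) * r = r * s := by rw [← add_mul, mul_comm]; congr 1; omega
    exact natDegree_mul_le.trans (by
      have := natDegree_mul_le (p := C (U.coeff i) * T - C (V.coeff i) * S) (q := A ^ i)
      omega)
  have hG0 : G = 0 := by
    by_contra hG0
    have hsub : t.biUnion (fun c => (A - C c * B).roots.toFinset) ⊆ G.roots.toFinset := by
      intro x hx
      obtain ⟨c, hc, hx⟩ := Finset.mem_biUnion.mp hx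
      rw [hroot c hc] at hx
      rw [Multiset.mem_toFinset, mem_roots hG0, IsRoot, hGeval x c hx, hUVc c hc x hx, mul_zero]
    have hcard : (t.biUnion (fun c => (A - C c * B).roots.toFinset)).card = (2 * s + 1) * r := by
      rw [Finset.card_biUnion, Finset.sum_congr rfl (fun c hc => (ht' c hc).1.1), Finset.sum_const,
        htcard, smul_eq_mul]
      intro c hc c' hc' hcc'
      refine Finset.disjoint_left.mpr fun x hx hx' => hcc' ?_
      rw [hroot c hc] at hx
      rw [hroot c' hc'] at hx'
      exact (hratio hx).symm.trans (hratio hx')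
    have h₁ := Finset.card_le_card hsub
    have h₂ := Multiset.toFinset_card_le G.roots
    have h₃ := card_roots' G
    nlinarith
  have hid : ∀ᶠ x in cofinite, U.eval (A.eval x / B.eval x) * T.eval x
      = V.eval (A.eval x / B.eval x) * S.eval x := by
    filter_upwards [eventually_eval_ne_zero hB] with x hx
    have h₁ := hGeval x (A.eval x / B.eval x) (by field_simp)
    rw [hG0, eval_zero, eq_comm, mul_eq_zero] at h₁
    exact sub_eq_zero.mp (h₁.resolve_left (pow_ne_zero _ hx))
  have htend := tendsto_ratio h hr0
  have hV0 : V ≠ 0 := by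
    rintro rfl
    have hU0 : U ≠ 0 := by
      rintro rfl
      exact hUV0 rfl
    obtain ⟨x, ⟨h₁, h₂⟩, h₃⟩ := ((hid.and (eventually_eval_ne_zero hT)).and
      (htend.eventually (eventually_eval_ne_zero hU0))).exists
    simp only [eval_zero, zero_mul, mul_eq_zero] at h₁
    exact h₁.elim h₃ h₂
  refine ⟨U, V, hV0, ?_⟩
  filter_upwards [hid, eventually_eval_ne_zero hT,
    htend.eventually (eventually_eval_ne_zero hV0)] with x h₁ h₂ h₃
  rw [div_eq_div_iff h₂ h₃, h₁]
  ring

end RationalMapsOfTheLine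

/-! ### Even functions on the curve -/

section EvenFunctions

variable {L : Type*} [Field L] {W : Affine L}

/-- On the curve every polynomial in the coordinates is at most linear in `y`. -/
lemma exists_ev_eq_add_mul (p : L[X][Y]) : ∃ p₀ p₁ : L[X], ∀ P : W.Point, P ≠ 0 →
    ev p P = p₀.eval (xc P) + p₁.eval (xc P) * yc P := by
  induction p using Polynomial.induction_on' with
  | add p q hp hq =>
    obtain ⟨p₀, p₁, hp⟩ := hp
    obtain ⟨q₀, q₁, hq⟩ := hq
    refine ⟨p₀ + q₀, p₁ + q₁, fun P hP => ?_⟩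
    rw [ev_add, hp P hP, hq P hP, eval_add, eval_add]
    ring
  | monomial n a =>
    rw [← C_mul_X_pow_eq_monomial]
    induction n with
    | zero => exact ⟨a, 0, fun P _ => by simp⟩
    | succ n ih =>
      obtain ⟨p₀, p₁, hp⟩ := ih
      refine ⟨p₁ * (X ^ 3 + C W.a₂ * X ^ 2 + C W.a₄ * X + C W.a₆),
        p₀ - p₁ * (C W.a₁ * X + C W.a₃), fun P hP => ?_⟩
      have he := (Affine.equation_iff _ _).mp (equation_xc_yc hP)
      rw [pow_succ, ← mul_assoc, ev_mul, hp P hP, ev_Y]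
      simp only [eval_mul, eval_add, eval_sub, eval_pow, eval_X, eval_C]
      linear_combination p₁.eval (xc P) * he

variable [DecidableEq L] [IsAlgClosed L] [CharZero L] [W.IsElliptic]

/-- A rational function invariant under `P ↦ -P` is a rational function of `x`: symmetrize the
numerator over the norm of the denominator. -/
lemma IsRat.exists_eval_xc {u : W.Point → L} (hu : IsRat u)
    (heven : ∀ᶠ P in cofinite, u (-P) = u P) :
    ∃ A B : L[X], IsCoprime A B ∧ B ≠ 0 ∧
      ∀ᶠ P in cofinite, u P = A.eval (xc P) / B.eval (xc P) := by
  obtain ⟨f, h, hfh⟩ := hu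
  obtain ⟨f₀, f₁, hf⟩ := exists_ev_eq_add_mul (W := W) f
  obtain ⟨h₀, h₁, hh⟩ := exists_ev_eq_add_mul (W := W) h
  -- The sum and the product of `y(P)` and `y(-P)`.
  set s : L[X] := -(C W.a₁ * X + C W.a₃) with hs
  set q : L[X] := -(X ^ 3 + C W.a₂ * X ^ 2 + C W.a₄ * X + C W.a₆) with hq
  set A : L[X] := 2 * f₀ * h₀ + (f₀ * h₁ + f₁ * h₀) * s + 2 * f₁ * h₁ * q with hA
  set B : L[X] := 2 * (h₀ ^ 2 + h₀ * h₁ * s + h₁ ^ 2 * q) with hB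
  have key : ∀ᶠ P in (cofinite : Filter W.Point),
      B.eval (xc P) ≠ 0 ∧ u P = A.eval (xc P) / B.eval (xc P) := by
    filter_upwards [hfh, neg_eventually hfh, heven, eventually_ne_cofinite 0] with P h₁' h₂ h₃ hP
    rw [h₃] at h₂
    have he := (Affine.equation_iff _ _).mp (equation_xc_yc hP)
    have hP' : -P ≠ 0 := neg_ne_zero.mpr hP
    have hB' : B.eval (xc P) = 2 * (ev h P * ev h (-P)) := by
      rw [hh P hP, hh _ hP', xc_neg, yc_neg hP]
      simp only [hB, hs, hq, eval_mul, eval_add, eval_pow, eval_X, eval_C, eval_ofNat,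
        eval_neg]
      linear_combination (2 * h₁.eval (xc P) ^ 2) * he
    have hA' : A.eval (xc P) = ev f P * ev h (-P) + ev f (-P) * ev h P := by
      rw [hh P hP, hh _ hP', hf P hP, hf _ hP', xc_neg, yc_neg hP]
      simp only [hA, hs, hq, eval_mul, eval_add, eval_pow, eval_X, eval_C, eval_ofNat,
        eval_neg]
      linear_combination (2 * f₁.eval (xc P) * h₁.eval (xc P)) * he
    have hu₁ := h₁'.2
    have hu₂ := h₂.2
    have hn₁ := h₁'.1
    have hn₂ := h₂.1
    rw [eq_div_iff hn₁] at hu₁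
    rw [eq_div_iff hn₂] at hu₂
    have hB0 : B.eval (xc P) ≠ 0 := by
      rw [hB']
      exact mul_ne_zero two_ne_zero (mul_ne_zero hn₁ hn₂)
    refine ⟨hB0, ?_⟩
    rw [eq_div_iff hB0, hA', hB']
    linear_combination ev h (-P) * hu₁ + ev h P * hu₂
  have := cofinite_neBot (W := W)
  have hB0 : B ≠ 0 := by
    intro h0
    obtain ⟨P, hP, -⟩ := key.exists
    exact hP (by rw [h0, eval_zero])
  obtain ⟨g, A', B', hcop, hg, hB'0, hAg, hBg⟩ := exists_coprime_of_ne_zero A hB0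
  refine ⟨A', B', hcop, hB'0, ?_⟩
  filter_upwards [key, eventually_eval_xc_ne_zero hg] with P h₁ h₂
  rw [h₁.2, hAg, hBg, eval_mul, eval_mul, mul_div_mul_left _ _ h₂]

end EvenFunctions

/-! ### The odd function `2y + a₁x + a₃` -/

section Fibres

variable {L : Type*} [Field L] {W : Affine L}

/-- The odd function `2y + a₁x + a₃`, as the difference of `y` at `P` and at `-P`. -/
def oddY (P : W.Point) : L := yc P - yc (-P)

lemma oddY_neg (P : W.Point) : oddY (-P) = -oddY P := by
  have : - -P = P := neg_neg P
  rw [oddY, oddY, this, neg_sub]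

lemma oddY_eq {P : W.Point} (hP : P ≠ 0) : oddY P = 2 * yc P + W.a₁ * xc P + W.a₃ := by
  rw [oddY, yc_neg hP]
  ring

lemma oddY_sq {P : W.Point} (hP : P ≠ 0) : oddY P ^ 2 = W.Ψ₂Sq.eval (xc P) := by
  have he := (Affine.equation_iff _ _).mp (equation_xc_yc hP)
  rw [oddY_eq hP, Ψ₂Sq, b₂, b₄, b₆]
  simp only [eval_add, eval_mul, eval_C, eval_pow, eval_X]
  linear_combination 4 * he

lemma isRat_oddY : IsRat (oddY : W.Point → L) := by
  refine (((IsRat.const 2).mul IsRat.yCoord).add (((IsRat.const W.a₁).mul IsRat.xCoord).add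
    (IsRat.const W.a₃))).congr ?_
  filter_upwards [eventually_ne_cofinite 0] with P hP
  rw [oddY_eq hP]
  ring

variable [DecidableEq L]

lemma eventually_oddY_ne_zero [CharZero L] : ∀ᶠ P in (cofinite : Filter W.Point), oddY P ≠ 0 := by
  have h4 : (4 : L) ≠ 0 := by norm_num
  filter_upwards [eventually_ne_cofinite 0, eventually_eval_xc_ne_zero (W.Ψ₂Sq_ne_zero h4)]
    with P h₁ h₂ h
  rw [← oddY_sq h₁, h] at h₂
  simp at h₂

lemma eventually_neg_ne [CharZero L] : ∀ᶠ P in (cofinite : Filter W.Point), -P ≠ P := by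
  filter_upwards [eventually_oddY_ne_zero] with P hP h
  exact hP (by rw [oddY, h, sub_self])

end Fibres

/-! ### Degree and factorization of isogenies -/

section Degree

section

variable {L : Type*} [Field L] [DecidableEq L] {W₁ W₂ : Affine L} {f : W₁.Point →+ W₂.Point}

/-- If `f` acts on `x`-coordinates by `A / B`, then for almost all `Q` the points `P` with
`f P = ± Q` are the points over the roots of `A - x(Q) B`. -/
lemma eventually_map_eq_iff {A B : L[X]} (hf : IsRatHom f) (hAB : IsCoprime A B)
    (h : ∀ᶠ P in cofinite, xc (f P) = A.eval (xc P) / B.eval (xc P))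
    (hr : 0 < max A.natDegree B.natDegree) :
    ∀ᶠ Q in cofinite, ∀ P, P ≠ 0 →
      ((f P = Q ∨ f P = -Q) ↔ A.eval (xc P) = xc Q * B.eval (xc P)) := by
  have hB : B ≠ 0 := by
    rintro rfl
    have := natDegree_eq_zero_of_isUnit (isCoprime_zero_right.mp hAB)
    simp [this] at hr
  have hgood := (h.and hf.eventually_ne_zero).and (eventually_eval_xc_ne_zero hB)
  have hfin := eventually_cofinite.mp hgood
  filter_upwards [(hfin.image f).eventually_cofinite_notMem,
    (hfin.image fun P => f (-P)).eventually_cofinite_notMem,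
    tendsto_xc.eventually
      (hfin.image fun P => A.eval (xc P) / B.eval (xc P)).eventually_cofinite_notMem,
    eventually_ne_cofinite 0] with Q h₁ h₂ h₃ hQ P hP
  constructor
  · intro hPQ
    have hg : (xc (f P) = A.eval (xc P) / B.eval (xc P) ∧ f P ≠ 0) ∧ B.eval (xc P) ≠ 0 := by
      by_contra hbad
      rcases hPQ with hPQ | hPQ
      · exact h₁ ⟨P, hbad, hPQ⟩
      · exact h₂ ⟨P, hbad, by simp [hPQ]⟩
    have hx : xc (f P) = xc Q := by rcases hPQ with hPQ | hPQ <;> simp [hPQ]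
    have hne := hg.2
    rw [← hx, hg.1.1]
    field_simp
  · intro hPQ
    have hne := eval_ne_zero_of_isCoprime_of_eval_eq hAB hPQ
    have hq : A.eval (xc P) / B.eval (xc P) = xc Q := by rw [hPQ]; field_simp
    have hg : (xc (f P) = A.eval (xc P) / B.eval (xc P) ∧ f P ≠ 0) ∧ B.eval (xc P) ≠ 0 := by
      by_contra hbad
      exact h₃ ⟨P, hbad, hq⟩
    exact eq_or_eq_neg_of_xc_eq hg.1.2 hQ (hg.1.1.trans hq)

end

variable {L : Type*} [Field L] [DecidableEq L] [IsAlgClosed L] [CharZero L]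
variable {W₁ W₂ W₃ : Affine L} [W₁.IsElliptic] {f : W₁.Point →+ W₂.Point}

/-- A rational homomorphism acts on `x`-coordinates through a nonconstant rational function. -/
lemma IsRatHom.exists_eval_xc (hf : IsRatHom f) : ∃ A B : L[X], IsCoprime A B ∧
    0 < max A.natDegree B.natDegree ∧
    ∀ᶠ P in cofinite, xc (f P) = A.eval (xc P) / B.eval (xc P) := by
  obtain ⟨A, B, hAB, hB, h⟩ := hf.x.exists_eval_xc (Eventually.of_forall fun P => by simp)
  refine ⟨A, B, hAB, ?_, h⟩
  by_contra! hdeg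
  obtain ⟨a, rfl⟩ := natDegree_eq_zero.mp (show A.natDegree = 0 by omega)
  obtain ⟨b, rfl⟩ := natDegree_eq_zero.mp (show B.natDegree = 0 by omega)
  have := cofinite_neBot (W := W₁)
  obtain ⟨P, hP, hP'⟩ := (h.and ((tendsto_xc.comp hf.tendsto).eventually
    (eventually_ne_cofinite (a / b)))).exists
  simp only [eval_C] at hP
  exact hP' hP

/-- A rational function of `P` that depends only on `x(f P)` is a rational function of `x(f P)`. -/
lemma IsRatHom.exists_eval_xc_of_factors (hf : IsRatHom f) {u : W₁.Point → L} (hu : IsRat u)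
    (hinv : ∀ P P', f P ≠ 0 → f P' ≠ 0 → xc (f P) = xc (f P') → u P = u P') :
    ∃ U V : L[X], V ≠ 0 ∧ ∀ᶠ P in cofinite, u P = U.eval (xc (f P)) / V.eval (xc (f P)) := by
  obtain ⟨A, B, hAB, hr, h⟩ := hf.exists_eval_xc
  obtain ⟨S, T, -, hT, hST⟩ := hu.exists_eval_xc (by
    filter_upwards [hf.eventually_ne_zero] with P hP
    exact hinv _ _ (by rw [map_neg]; exact neg_ne_zero.mpr hP) hP (by simp))
  have hgood := (h.and hST).and hf.eventually_ne_zero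
  obtain ⟨U, V, hV, hUV⟩ := exists_ratio_comp hAB hr hT
    ((eventually_cofinite.mp hgood).image xc) (S := S) (by
      intro x hx x' hx' he
      obtain ⟨P, hP, rfl⟩ := exists_xc_eq (W := W₁) x
      obtain ⟨P', hP', rfl⟩ := exists_xc_eq (W := W₁) x'
      obtain ⟨⟨h₁, h₂⟩, h₃⟩ := not_not.mp fun hbad => hx ⟨P, hbad, rfl⟩
      obtain ⟨⟨h₁', h₂'⟩, h₃'⟩ := not_not.mp fun hbad => hx' ⟨P', hbad, rfl⟩
      rw [← h₂, ← h₂']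
      exact hinv P P' h₃ h₃' (by rw [h₁, h₁', he]))
  refine ⟨U, V, hV, ?_⟩
  filter_upwards [h, hST, tendsto_xc.eventually hUV] with P h₁ h₂ h₃
  rw [h₂, h₃, h₁]

variable [W₂.IsElliptic]

/-- A rational homomorphism is surjective: it hits almost all points, and its image is a
subgroup. -/
lemma IsRatHom.surjective (hf : IsRatHom f) : Function.Surjective f := by
  obtain ⟨A, B, hAB, hr, h⟩ := hf.exists_eval_xc
  have hev : ∀ᶠ Q in cofinite, Q ∈ f.range := by
    filter_upwards [eventually_map_eq_iff hf hAB h hr,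
      tendsto_xc.eventually (eventually_card_roots hAB rfl hr)] with Q h₁ h₂
    have : (A - C (xc Q) * B).roots.toFinset.Nonempty := by
      rw [← Finset.card_pos, h₂.1]
      exact hr
    obtain ⟨x, hx⟩ := this
    rw [Multiset.mem_toFinset, mem_roots h₂.2, IsRoot, eval_sub, eval_mul, eval_C,
      sub_eq_zero] at hx
    obtain ⟨P, hP, rfl⟩ := exists_xc_eq (W := W₁) x
    rcases (h₁ P hP).mpr hx with h | h
    · exact ⟨P, h⟩
    · exact ⟨-P, by rw [map_neg, h, neg_neg]⟩
  intro Q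
  have := cofinite_neBot (W := W₂)
  obtain ⟨R, h₁, h₂⟩ := (hev.and (((add_left_injective Q).tendsto_cofinite).eventually hev)).exists
  -- `R` and `R + Q` are both in the image.
  have h₃ := f.range.sub_mem h₂ h₁
  rwa [add_sub_cancel_left] at h₃

/-- The order of the kernel is the degree of the rational function by which the homomorphism acts
on `x`-coordinates: both count the points over a general point. -/
lemma IsRatHom.card_ker_eq (hf : IsRatHom f) {A B : L[X]} (hAB : IsCoprime A B)
    (h : ∀ᶠ P in cofinite, xc (f P) = A.eval (xc P) / B.eval (xc P))
    (hr : 0 < max A.natDegree B.natDegree) :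
    Nat.card f.ker = max A.natDegree B.natDegree := by
  have := cofinite_neBot (W := W₂)
  obtain ⟨Q, ⟨⟨h₁, h₂, h₃⟩, h₄⟩, h₅⟩ := (((eventually_map_eq_iff hf hAB h hr).and
    (tendsto_xc.eventually (eventually_card_roots hAB rfl hr))).and
    (eventually_neg_ne (W := W₂))).and (eventually_ne_cofinite 0) |>.exists
  have hmem : ∀ x, x ∈ (A - C (xc Q) * B).roots.toFinset ↔ A.eval x = xc Q * B.eval x := by
    intro x
    rw [Multiset.mem_toFinset, mem_roots h₃, IsRoot, eval_sub, eval_mul, eval_C, sub_eq_zero]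
  have hne : ∀ P, f P = Q → P ≠ 0 := by
    rintro P hP rfl
    exact h₅ (hP ▸ map_zero f)
  obtain ⟨P₀, hP₀⟩ := hf.surjective Q
  have hK : ∀ K : f.ker, f (P₀ + K) = Q := fun K => by
    rw [map_add, hP₀, AddMonoidHom.mem_ker.mp K.2, add_zero]
  rw [← h₂, ← Nat.card_eq_finsetCard]
  -- As `-Q ≠ Q`, every root is the `x`-coordinate of exactly one point over `Q`.
  refine Nat.card_eq_of_bijective (fun K : f.ker => (⟨xc (P₀ + (K : W₁.Point)), (hmem _).mpr
    ((h₁ _ (hne _ (hK K))).mp (Or.inl (hK K)))⟩ : (A - C (xc Q) * B).roots.toFinset)) ⟨?_, ?_⟩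
  · intro K K' hKK
    have hx : xc (P₀ + (K : W₁.Point)) = xc (P₀ + (K' : W₁.Point)) := congrArg Subtype.val hKK
    rcases eq_or_eq_neg_of_xc_eq (hne _ (hK K)) (hne _ (hK K')) hx with he | he
    · exact Subtype.ext (add_left_cancel he)
    · have h₆ := hK K
      rw [he, map_neg, hK K'] at h₆
      exact absurd h₆ h₄
  · rintro ⟨x, hx⟩
    obtain ⟨P, hP, rfl⟩ := exists_xc_eq (W := W₁) x
    rw [hmem] at hx
    have key : ∀ P', f P' = Q → xc P' = xc P → ∃ K : f.ker, xc (P₀ + (K : W₁.Point)) = xc P := by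
      intro P' hP' hx'
      refine ⟨⟨P' - P₀, ?_⟩, ?_⟩
      · rw [AddMonoidHom.mem_ker, map_sub, hP', hP₀, sub_self]
      · rw [add_sub_cancel, hx']
    rcases (h₁ P hP).mpr hx with h | h
    · exact (key P h rfl).imp fun K hK => Subtype.ext hK
    · exact (key (-P) (by rw [map_neg, h, neg_neg]) (xc_neg P)).imp fun K hK => Subtype.ext hK

/-- The quotient property of isogenies: a rational homomorphism that kills the kernel of another
one factors through it, and the factor is rational. -/
theorem IsRatHom.exists_factor (hf : IsRatHom f) {g : W₁.Point →+ W₃.Point} (hg : IsRatHom g)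
    (hker : f.ker ≤ g.ker) : ∃ l : W₂.Point →+ W₃.Point, IsRatHom l ∧ l.comp f = g := by
  obtain ⟨l, hl⟩ : ∃ l : W₂.Point →+ W₃.Point, l.comp f = g :=
    ⟨f.liftOfSurjective hf.surjective ⟨g, hker⟩,
      f.liftOfRightInverse_comp _ _ _⟩
  have hl' : ∀ P, l (f P) = g P := fun P => DFunLike.congr_fun hl P
  have push : ∀ {p : W₂.Point → Prop}, (∀ᶠ P in cofinite, p (f P)) → ∀ᶠ Q in cofinite, p Q := by
    intro p hp
    rw [eventually_cofinite] at hp ⊢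
    refine (hp.image f).subset fun Q hQ => ?_
    obtain ⟨P, rfl⟩ := hf.surjective Q
    exact ⟨P, hQ, rfl⟩
  have hpm : ∀ P P', f P ≠ 0 → f P' ≠ 0 → xc (f P) = xc (f P') →
      (f P = f P' ∧ g P = g P') ∨ (f P = -f P' ∧ g P = -g P') := by
    intro P P' h₁ h₂ h₃
    rcases eq_or_eq_neg_of_xc_eq h₁ h₂ h₃ with h | h
    · exact Or.inl ⟨h, by rw [← hl', ← hl', h]⟩
    · exact Or.inr ⟨h, by rw [← hl', ← hl', h, map_neg]⟩
  obtain ⟨U, V, hV, hUV⟩ := hf.exists_eval_xc_of_factors hg.x (by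
    intro P P' h₁ h₂ h₃
    rcases hpm P P' h₁ h₂ h₃ with ⟨-, h⟩ | ⟨-, h⟩ <;> simp [h])
  -- The `y`-coordinate is not even; the quotient of odd functions is, and it determines `y (l Q)`.
  obtain ⟨U', V', hV', hUV'⟩ := hf.exists_eval_xc_of_factors
    (u := fun P => oddY (g P) / oddY (f P))
    ((hg.isRat_comp isRat_oddY).div (hf.isRat_comp isRat_oddY)
      (hf.tendsto.eventually eventually_oddY_ne_zero)) (by
    intro P P' h₁ h₂ h₃
    rcases hpm P P' h₁ h₂ h₃ with ⟨h, h'⟩ | ⟨h, h'⟩ <;> simp [h, h', oddY_neg])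
  simp only [← hl'] at hUV hUV'
  have hfin : (l.ker : Set W₂.Point).Finite := by
    refine (hg.finite_ker.image f).subset fun Q hQ => ?_
    obtain ⟨P, rfl⟩ := hf.surjective Q
    exact ⟨P, (hl' P).symm.trans hQ, rfl⟩
  have hne : ∀ᶠ Q in cofinite, l Q ≠ 0 :=
    (tendsto_cofinite_of_finite_fibers (finite_fibers_of_finite_ker hfin)).eventually
      (eventually_ne_cofinite 0)
  have hx : IsRat fun Q => xc (l Q) :=
    ((IsRat.xCoord.eval_comp U).div (IsRat.xCoord.eval_comp V)
      (eventually_eval_xc_ne_zero hV)).congr (push hUV)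
  refine ⟨l, ⟨hx, ?_, hfin⟩, hl⟩
  have hy := (((IsRat.xCoord.eval_comp U').div (IsRat.xCoord.eval_comp V')
      (eventually_eval_xc_ne_zero hV')).mul (isRat_oddY (W := W₂)))
  refine ((IsRat.const (1 / 2)).mul (hy.sub (((IsRat.const W₃.a₁).mul hx).add
    (IsRat.const W₃.a₃)))).congr ?_
  filter_upwards
    [push (p := fun Q => oddY (l Q) / oddY Q = U'.eval (xc Q) / V'.eval (xc Q)) hUV', hne,
    eventually_oddY_ne_zero (W := W₂)] with Q h₁ h₂ h₃
  have h₄ := oddY_eq h₂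
  rw [← h₁, div_mul_cancel₀ _ h₃, h₄]
  ring

end Degree

/-! ### Addition formulas -/

section Formulas

variable {L : Type*} [Field L] [DecidableEq L] {W : Affine L}

lemma xc_add_add_xc_sub {P Q : W.Point} (hP : P ≠ 0) (hQ : Q ≠ 0) (h : xc P ≠ xc Q) :
    (xc (P + Q) + xc (P - Q)) * (xc P - xc Q) ^ 2 = 2 * (xc P + xc Q) * (xc P * xc Q)
      + W.b₂ * (xc P * xc Q) + W.b₄ * (xc P + xc Q) + W.b₆ := by
  have h₁ := (Affine.equation_iff _ _).mp (equation_xc_yc hP)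
  have h₂ := (Affine.equation_iff _ _).mp (equation_xc_yc hQ)
  have hd : xc P - xc Q ≠ 0 := sub_ne_zero.mpr h
  rw [sub_eq_add_neg P, xc_add hP hQ h, xc_add hP (neg_ne_zero.mpr hQ) (by rwa [xc_neg]), xc_neg,
    yc_neg hQ, b₂, b₄, b₆]
  field_simp
  linear_combination 2 * h₁ + 2 * h₂

lemma xc_add_mul_xc_sub {P Q : W.Point} (hP : P ≠ 0) (hQ : Q ≠ 0) (h : xc P ≠ xc Q) :
    xc (P + Q) * xc (P - Q) * (xc P - xc Q) ^ 2 = (xc P * xc Q) ^ 2 - W.b₄ * (xc P * xc Q)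
      - W.b₆ * (xc P + xc Q) - W.b₈ := by
  have h₁ := (Affine.equation_iff _ _).mp (equation_xc_yc hP)
  have h₂ := (Affine.equation_iff _ _).mp (equation_xc_yc hQ)
  have hd : xc P - xc Q ≠ 0 := sub_ne_zero.mpr h
  rw [sub_eq_add_neg P, xc_add hP hQ h, xc_add hP (neg_ne_zero.mpr hQ) (by rwa [xc_neg]), xc_neg,
    yc_neg hQ, b₄, b₆, b₈]
  field_simp
  generalize xc P = x at *
  generalize xc Q = x' at *
  generalize yc P = y at *
  generalize yc Q = y' at *
  grind

lemma two_nsmul_coords {P : W.Point} (hP : P ≠ 0) (h : oddY P ≠ 0) :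
    (2 • P : W.Point) ≠ 0 ∧
    xc (2 • P) = ((3 * xc P ^ 2 + 2 * W.a₂ * xc P + W.a₄ - W.a₁ * yc P) / oddY P) ^ 2
      + W.a₁ * ((3 * xc P ^ 2 + 2 * W.a₂ * xc P + W.a₄ - W.a₁ * yc P) / oddY P) - W.a₂
      - xc P - xc P ∧
    yc (2 • P) = -(((3 * xc P ^ 2 + 2 * W.a₂ * xc P + W.a₄ - W.a₁ * yc P) / oddY P)
      * (xc (2 • P) - xc P) + yc P) - W.a₁ * xc (2 • P) - W.a₃ := by
  rcases P with _ | ⟨x, y, hns⟩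
  · exact absurd rfl hP
  have hy : y ≠ W.negY x y := fun he => h (sub_eq_zero.mpr he)
  rw [two_nsmul, Affine.Point.add_self_of_Y_ne hy]
  refine ⟨Affine.Point.some_ne_zero _, ?_, ?_⟩
  · simp only [xc_some, yc_some, Affine.slope_of_Y_ne rfl hy]
    rfl
  · simp only [xc_some, yc_some, Affine.slope_of_Y_ne rfl hy]
    rfl

lemma xc_two_nsmul {P : W.Point} (hP : P ≠ 0) (h : oddY P ≠ 0) :
    xc (2 • P) = (X ^ 4 - C W.b₄ * X ^ 2 - 2 * C W.b₆ * X - C W.b₈ : L[X]).eval (xc P)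
      / W.Ψ₂Sq.eval (xc P) := by
  have h₁ := (Affine.equation_iff _ _).mp (equation_xc_yc hP)
  rw [(two_nsmul_coords hP h).2.1, ← oddY_sq hP, b₄, b₆, b₈]
  have h₂ := oddY_eq hP
  simp only [eval_sub, eval_mul, eval_C, eval_pow, eval_X, eval_ofNat]
  field_simp
  rw [h₂]
  generalize xc P = x at *
  generalize yc P = y at *
  grind

end Formulas

/-! ### Multiplication by `n` and its degree -/

section Multiplication

lemma natDegree_eq_zero_of_forall_eval_ne_zero {L : Type*} [Field L] [IsAlgClosed L] {p : L[X]}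
    (h : ∀ x, p.eval x ≠ 0) : p.natDegree = 0 := by
  by_contra h0
  obtain ⟨x, hx⟩ := IsAlgClosed.exists_root p (fun hd => h0 (natDegree_eq_of_degree_eq_some hd))
  exact h x hx

/-- The formulas for the sum and the product of `x(P + Q)` and `x(P - Q)` have no common zero. -/
lemma addSub_ne_zero {L : Type*} [Field L] {W : Affine L} [W.IsElliptic] {s t u : L}
    (h : u = 0 → t ≠ 0) :
    t ^ 2 - 4 * s * u = 0 → 2 * t * s + W.b₂ * s * u + W.b₄ * t * u + W.b₆ * u ^ 2 = 0 →
    s ^ 2 - W.b₄ * s * u - W.b₆ * t * u - W.b₈ * u ^ 2 ≠ 0 := by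
  intro h₀ h₁ h₂
  have hne : (![s, t, u] : Fin 3 → L) ≠ 0 := fun h0 => by
    have hu : u = 0 := congrFun h0 2
    have ht : t = 0 := congrFun h0 1
    exact h hu ht
  apply addSubMap_ne_zero W hne
  funext i
  fin_cases i
  · simpa [addSubMap] using h₂
  · simpa [addSubMap] using h₁
  · simpa [addSubMap] using h₀

variable {L : Type*} [Field L] [DecidableEq L]

/-- Two proportional triples of polynomials, each without common zeros, differ by a constant. In
particular their degrees agree. -/
lemma natDegree_eq_of_proportional [IsAlgClosed L] {F₀ F₁ F₂ U₀ U₁ U₂ : L[X]}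
    (hF : ∀ x, F₀.eval x = 0 → F₁.eval x = 0 → F₂.eval x ≠ 0)
    (hU : ∀ x, U₀.eval x = 0 → U₁.eval x = 0 → U₂.eval x ≠ 0)
    (hF₀ : F₀ ≠ 0) (hU₀ : U₀ ≠ 0) (h₁ : U₁ * F₀ = F₁ * U₀) (h₂ : U₂ * F₀ = F₂ * U₀) :
    U₁.natDegree = F₁.natDegree ∧ U₂.natDegree = F₂.natDegree := by
  obtain ⟨g, a, b, hab, hg, hb, hFg, hUg⟩ := exists_coprime_of_ne_zero F₀ hU₀
  have ha : a ≠ 0 := by rintro rfl; exact hF₀ (by rw [hFg, mul_zero])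
  have e₁ : U₁ * a = F₁ * b := mul_left_cancel₀ hg (by rw [hFg, hUg] at h₁; linear_combination h₁)
  have e₂ : U₂ * a = F₂ * b := mul_left_cancel₀ hg (by rw [hFg, hUg] at h₂; linear_combination h₂)
  have ha0 : a.natDegree = 0 := natDegree_eq_zero_of_forall_eval_ne_zero fun x hx => by
    have hbx := eval_ne_zero_of_isCoprime hab.symm hx
    refine hF x (by rw [hFg, eval_mul, hx, mul_zero]) ?_ ?_
    · have := congrArg (Polynomial.eval x) e₁
      rw [eval_mul, eval_mul, hx, mul_zero, eq_comm, mul_eq_zero] at this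
      exact this.resolve_right hbx
    · have := congrArg (Polynomial.eval x) e₂
      rw [eval_mul, eval_mul, hx, mul_zero, eq_comm, mul_eq_zero] at this
      exact this.resolve_right hbx
  have hb0 : b.natDegree = 0 := natDegree_eq_zero_of_forall_eval_ne_zero fun x hx => by
    have hax := eval_ne_zero_of_isCoprime hab hx
    refine hU x (by rw [hUg, eval_mul, hx, mul_zero]) ?_ ?_
    · have := congrArg (Polynomial.eval x) e₁
      rw [eval_mul, eval_mul, hx, mul_zero, mul_eq_zero] at this
      exact this.resolve_right hax
    · have := congrArg (Polynomial.eval x) e₂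
      rw [eval_mul, eval_mul, hx, mul_zero, mul_eq_zero] at this
      exact this.resolve_right hax
  have key : ∀ {U F : L[X]}, U * a = F * b → U.natDegree = F.natDegree := by
    intro U F h
    by_cases hU : U = 0
    · rw [hU, zero_mul, eq_comm, mul_eq_zero] at h
      rw [hU, h.resolve_right hb]
    · have hF : F ≠ 0 := by
        rintro rfl
        rw [zero_mul, mul_eq_zero] at h
        exact h.elim hU ha
      have := congrArg natDegree h
      rwa [natDegree_mul hU ha, natDegree_mul hF hb, ha0, hb0] at this
  exact ⟨key e₁, key e₂⟩

/-- Multiplication by `n` acts on `x`-coordinates by `A / B` in lowest terms, where `A` has degree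
`n ^ 2` and `B` smaller degree. -/
def ActsOnX (W : Affine L) (n : ℕ) (A B : L[X]) : Prop :=
  IsCoprime A B ∧ A.natDegree = n ^ 2 ∧ B.natDegree < n ^ 2 ∧
    ∀ᶠ P in (cofinite : Filter W.Point), n • P ≠ 0 ∧ B.eval (xc P) ≠ 0 ∧
      xc (n • P) = A.eval (xc P) / B.eval (xc P)

variable {W : Affine L}

lemma actsOnX_one : ActsOnX W 1 X 1 := by
  refine ⟨isCoprime_one_right, by simp, by simp, ?_⟩
  filter_upwards [eventually_ne_cofinite 0] with P hP
  simpa using hP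

variable [IsAlgClosed L] [W.IsElliptic]

/-- The inductive step from `m` and `m + 1` to `m + 2`. The `x`-coordinates of `(m + 1)P ± P` are
the roots of a quadratic polynomial whose coefficients `F₀`, `F₁`, `F₂` are without common zeros;
this determines the degree of the product of their numerators. -/
lemma ActsOnX.step {m : ℕ} (hm : 0 < m) {A₀ B₀ A B : L[X]} (h₀ : ActsOnX W m A₀ B₀)
    (h₁ : ActsOnX W (m + 1) A B) : ∃ A' B', ActsOnX W (m + 2) A' B' := by
  obtain ⟨hcop₀, hA₀, hB₀, hev₀⟩ := h₀
  obtain ⟨hcop, hA, hB, hev⟩ := h₁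
  have hm2 : 4 ≤ (m + 1) ^ 2 := by nlinarith
  -- With `x((m + 1)P) = A / B` and `x = x(P)`, the product and the sum of these two `x`-coordinates
  -- are `s / B` and `t / B`.
  set s := X * A with hs
  set t := X * B + A with ht
  set F₀ := t ^ 2 - 4 * s * B with hF₀
  set F₁ := 2 * t * s + C W.b₂ * s * B + C W.b₄ * t * B + C W.b₆ * B ^ 2 with hF₁
  set F₂ := s ^ 2 - C W.b₄ * s * B - C W.b₆ * t * B - C W.b₈ * B ^ 2 with hF₂
  have hAX : A - X * B ≠ 0 := by
    intro h0
    rw [sub_eq_zero] at h0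
    have hu : IsUnit B := isCoprime_self.mp (by rw [h0] at hcop; exact hcop.of_mul_left_right)
    have := natDegree_mul_le (p := X) (q := B)
    rw [← h0, natDegree_eq_zero_of_isUnit hu, natDegree_X] at this
    omega
  have hF₀' : F₀ = (A - X * B) ^ 2 := by rw [hF₀, ht, hs]; ring
  have hF₀0 : F₀ ≠ 0 := hF₀' ▸ pow_ne_zero 2 hAX
  have hB₀0 : B₀ ≠ 0 := by
    rintro rfl
    have := natDegree_eq_zero_of_isUnit (isCoprime_zero_right.mp hcop₀)
    rw [natDegree_zero] at hB₀
    omega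
  have hA₀0 : A₀ ≠ 0 := by
    rintro rfl
    rw [natDegree_zero] at hA₀
    omega
  have hA0 : A ≠ 0 := by
    rintro rfl
    rw [natDegree_zero] at hA
    omega
  obtain ⟨g, A', B', hcop', hg, hB'0, hAg, hBg⟩ :=
    exists_coprime_of_ne_zero (F₁ * B₀ - A₀ * F₀) (mul_ne_zero hF₀0 hB₀0)
  have hpt : ∀ᶠ P in (cofinite : Filter W.Point), (m + 2) • P ≠ 0 ∧ B'.eval (xc P) ≠ 0 ∧
      xc ((m + 2) • P) = A'.eval (xc P) / B'.eval (xc P) ∧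
      A'.eval (xc P) * A₀.eval (xc P) * F₀.eval (xc P) =
        F₂.eval (xc P) * (B'.eval (xc P) * B₀.eval (xc P)) := by
    filter_upwards [hev₀, hev, eventually_ne_cofinite 0, eventually_eval_xc_ne_zero hAX,
      eventually_eval_xc_ne_zero hg, eventually_eval_xc_ne_zero hB'0]
      with P ⟨h₁, h₂, h₃⟩ ⟨h₄, h₅, h₆⟩ hP h₇ h₈ h₉
    have hne : xc ((m + 1) • P) ≠ xc P := by
      intro he
      rw [h₆, div_eq_iff h₅] at he
      exact h₇ (by rw [eval_sub, he, eval_mul, eval_X, sub_self])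
    have e₁ : (m + 2) • P = (m + 1) • P + P := by rw [← succ_nsmul]
    have e₂ : m • P = (m + 1) • P - P := by rw [succ_nsmul, add_sub_cancel_right]
    have hsum := xc_add_add_xc_sub h₄ hP hne
    have hprod := xc_add_mul_xc_sub h₄ hP hne
    rw [← e₁, ← e₂, h₃, h₆] at hsum hprod
    have hA'' := congrArg (Polynomial.eval (xc P)) hAg
    have hB'' := congrArg (Polynomial.eval (xc P)) hBg
    rw [hF₀'] at hA'' hB''
    rw [hF₀']
    simp only [hF₁, hF₂, ht, hs, eval_add, eval_sub, eval_mul, eval_C, eval_pow, eval_X,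
      eval_ofNat] at hA'' hB'' h₇ ⊢
    generalize xc ((m + 2) • P) = z at *
    have hz : z = A'.eval (xc P) / B'.eval (xc P) := by
      rw [eq_div_iff h₉]
      apply mul_left_cancel₀ h₈
      field_simp at hsum
      linear_combination hsum - z * hB'' + hA''
    refine ⟨e₁ ▸ add_ne_zero_of_xc_ne hne, h₉, hz, ?_⟩
    rw [hz] at hprod
    field_simp at hprod
    linear_combination hprod
  have hprod : A' * A₀ * F₀ = F₂ * (B' * B₀) := eq_of_eventually_eval_xc_eq (W := W) (by
    filter_upwards [hpt] with P hP
    simpa only [eval_mul] using hP.2.2.2)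
  have hsum : (A' * B₀ + B' * A₀) * F₀ = F₁ * (B' * B₀) := by
    apply mul_left_cancel₀ hg
    linear_combination (-B₀ * F₀) * hAg + (F₁ * B₀ - A₀ * F₀) * hBg
  obtain ⟨hd₁, hd₂⟩ := natDegree_eq_of_proportional (F₀ := F₀) (F₁ := F₁) (F₂ := F₂)
    (U₀ := B' * B₀) (U₁ := A' * B₀ + B' * A₀) (U₂ := A' * A₀) (by
      intro x
      have := addSub_ne_zero (W := W) (s := s.eval x) (t := t.eval x) (u := B.eval x) (by
        intro hu
        rw [ht, eval_add, eval_mul, hu, mul_zero, zero_add]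
        exact eval_ne_zero_of_isCoprime hcop hu)
      simpa only [hF₀, hF₁, hF₂, eval_add, eval_sub, eval_mul, eval_C, eval_pow,
        eval_ofNat] using this) (by
      intro x hx₀ hx₁ hx₂
      simp only [eval_mul, eval_add, mul_eq_zero] at hx₀ hx₁ hx₂
      have c' := fun h => eval_ne_zero_of_isCoprime hcop' (x := x) h
      have c₀ := fun h => eval_ne_zero_of_isCoprime hcop₀ (x := x) h
      rcases hx₀ with hx | hx
      · rw [hx, zero_mul, add_zero, mul_eq_zero] at hx₁
        have := hx₁.resolve_left (c' hx)
        exact hx₂.elim (c' hx) (c₀ this)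
      · rw [hx, mul_zero, zero_add, mul_eq_zero] at hx₁
        have := hx₁.resolve_right (c₀ hx)
        exact hx₂.elim (c' this) (c₀ hx)) hF₀0 (mul_ne_zero hB'0 hB₀0) hsum hprod
  have ds : s.natDegree = (m + 1) ^ 2 + 1 := by rw [hs, natDegree_X_mul hA0, hA]
  have dt : t.natDegree ≤ (m + 1) ^ 2 := by
    refine (natDegree_add_le _ _).trans (max_le ?_ hA.le)
    have := natDegree_mul_le (p := X) (q := B)
    rw [natDegree_X] at this
    omega
  have bound : ∀ (c : L) (p q : L[X]), p.natDegree + q.natDegree < 2 * ((m + 1) ^ 2 + 1) →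
      (C c * p * q).natDegree < 2 * ((m + 1) ^ 2 + 1) := fun c p q h =>
    (natDegree_mul_le.trans (Nat.add_le_add_right (natDegree_C_mul_le c p) _)).trans_lt h
  have dF₂ : F₂.natDegree = 2 * ((m + 1) ^ 2 + 1) := by
    have hs2 : (s ^ 2).natDegree = 2 * ((m + 1) ^ 2 + 1) := by rw [natDegree_pow, ds]
    have e : F₂ = s ^ 2 - (C W.b₄ * s * B + C W.b₆ * t * B + C W.b₈ * B * B) := by rw [hF₂]; ring
    rw [e, natDegree_sub_eq_left_of_natDegree_lt, hs2]
    rw [hs2]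
    exact (natDegree_add_le _ _).trans_lt (max_lt ((natDegree_add_le _ _).trans_lt (max_lt
      (bound _ _ _ (by omega)) (bound _ _ _ (by omega)))) (bound _ _ _ (by omega)))
  have dF₁ : F₁.natDegree < 2 * ((m + 1) ^ 2 + 1) := by
    have e : F₁ = C 2 * t * s + C W.b₂ * s * B + C W.b₄ * t * B + C W.b₆ * B * B := by
      rw [hF₁, C_ofNat]; ring
    rw [e]
    exact (natDegree_add_le _ _).trans_lt (max_lt ((natDegree_add_le _ _).trans_lt (max_lt
      ((natDegree_add_le _ _).trans_lt (max_lt (bound _ _ _ (by omega)) (bound _ _ _ (by omega))))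
      (bound _ _ _ (by omega)))) (bound _ _ _ (by omega)))
  have hA'0 : A' ≠ 0 := by
    rintro rfl
    rw [zero_mul, natDegree_zero, dF₂] at hd₂
    omega
  have dA' : A'.natDegree = (m + 2) ^ 2 := by
    rw [natDegree_mul hA'0 hA₀0, dF₂, hA₀] at hd₂
    nlinarith
  refine ⟨A', B', hcop', dA', ?_, hpt.mono fun P hP => ⟨hP.1, hP.2.1, hP.2.2.1⟩⟩
  -- Otherwise `B' * A₀` would be the dominant term of `A' * B₀ + B' * A₀`, of too large a degree.
  by_contra! hB'
  have h₁ : (A' * B₀).natDegree < (B' * A₀).natDegree := by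
    rw [natDegree_mul hA'0 hB₀0, natDegree_mul hB'0 hA₀0]
    omega
  rw [natDegree_add_eq_right_of_natDegree_lt h₁, natDegree_mul hB'0 hA₀0] at hd₁
  nlinarith

variable [CharZero L]

lemma actsOnX_two : ActsOnX W 2 (X ^ 4 - C W.b₄ * X ^ 2 - 2 * C W.b₆ * X - C W.b₈) W.Ψ₂Sq := by
  have h4 : (4 : L) ≠ 0 := by norm_num
  have hdeg : W.Ψ₂Sq.natDegree = 3 := W.natDegree_Ψ₂Sq h4
  refine ⟨?_, ?_, by rw [hdeg]; norm_num, ?_⟩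
  · rw [isCoprime_iff_aeval_ne_zero_of_isAlgClosed L L]
    intro x
    by_contra! h
    obtain ⟨h₂, h₁⟩ := h
    rw [coe_aeval_eq_eval, Ψ₂Sq] at h₁
    rw [coe_aeval_eq_eval] at h₂
    simp only [eval_add, eval_sub, eval_mul, eval_C, eval_pow, eval_X, eval_ofNat] at h₁ h₂
    refine addSub_ne_zero (W := W) (s := x ^ 2) (t := 2 * x) (u := 1) (fun h => ?_) (by ring)
      (by linear_combination h₁) (by linear_combination h₂)
    exact absurd h one_ne_zero
  · compute_degree!
  · filter_upwards [eventually_ne_cofinite 0, eventually_oddY_ne_zero] with P h₁ h₂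
    refine ⟨(two_nsmul_coords h₁ h₂).1, ?_, xc_two_nsmul h₁ h₂⟩
    rw [← oddY_sq h₁]
    exact pow_ne_zero 2 h₂

lemma exists_actsOnX {n : ℕ} (hn : 0 < n) : ∃ A B, ActsOnX W n A B := by
  have key : ∀ m : ℕ, (∃ A B, ActsOnX W (m + 1) A B) ∧ ∃ A B, ActsOnX W (m + 2) A B := by
    intro m
    induction m with
    | zero => exact ⟨⟨_, _, actsOnX_one⟩, ⟨_, _, actsOnX_two⟩⟩
    | succ m ih =>
      obtain ⟨⟨A₀, B₀, h₀⟩, A, B, h₁⟩ := ih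
      exact ⟨⟨A, B, h₁⟩, h₀.step (Nat.succ_pos m) h₁⟩
  obtain ⟨m, rfl⟩ : ∃ m, n = m + 1 := ⟨n - 1, by omega⟩
  exact (key m).1

lemma isRatHom_two_nsmul : IsRatHom (nsmulAddMonoidHom 2 : W.Point →+ W.Point) := by
  have hs : IsRat fun P : W.Point =>
      (3 * (xc P * xc P) + 2 * W.a₂ * xc P + W.a₄ - W.a₁ * yc P) / oddY P :=
    ((((((IsRat.const 3).mul (IsRat.xCoord.mul IsRat.xCoord)).add
      ((IsRat.const (2 * W.a₂)).mul IsRat.xCoord)).add (IsRat.const W.a₄)).sub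
      ((IsRat.const W.a₁).mul IsRat.yCoord))).div isRat_oddY eventually_oddY_ne_zero
  have hx : IsRat fun P : W.Point => xc (nsmulAddMonoidHom 2 P) := by
    refine ((((hs.mul hs).add ((IsRat.const W.a₁).mul hs)).sub (IsRat.const W.a₂)).sub
      (IsRat.xCoord.add IsRat.xCoord)).congr ?_
    filter_upwards [eventually_ne_cofinite 0, eventually_oddY_ne_zero] with P h₁ h₂
    rw [nsmulAddMonoidHom_apply, (two_nsmul_coords h₁ h₂).2.1]
    ring
  refine ⟨hx, ?_, ?_⟩
  · refine ((((hs.mul (hx.sub IsRat.xCoord)).add IsRat.yCoord).neg.sub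
      ((IsRat.const W.a₁).mul hx)).sub (IsRat.const W.a₃)).congr ?_
    filter_upwards [eventually_ne_cofinite 0, eventually_oddY_ne_zero] with P h₁ h₂
    rw [nsmulAddMonoidHom_apply, (two_nsmul_coords h₁ h₂).2.2]
    ring
  · refine (eventually_cofinite.mp (actsOnX_two (W := W)).2.2.2).subset fun P hP h => ?_
    exact h.1 hP

lemma isRatHom_nsmul {n : ℕ} (hn : 0 < n) :
    IsRatHom (nsmulAddMonoidHom n : W.Point →+ W.Point) := by
  induction n, hn using Nat.le_induction with
  | base =>
    have : (nsmulAddMonoidHom 1 : W.Point →+ W.Point) = AddMonoidHom.id _ := by ext; simp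
    exact this ▸ IsRatHom.id
  | succ n hn ih =>
    -- The chord formula does not apply to `P + P`, so that duplication is treated separately.
    obtain rfl | hn2 : n = 1 ∨ 2 ≤ n := by omega
    · exact isRatHom_two_nsmul
    have : (nsmulAddMonoidHom (n + 1) : W.Point →+ W.Point) =
        nsmulAddMonoidHom n + AddMonoidHom.id _ := by ext; simp [succ_nsmul]
    rw [this]
    refine ih.add IsRatHom.id ?_
    obtain ⟨A, B, hcop, hA, hB, hev⟩ := exists_actsOnX (W := W) hn
    have hAX : A - X * B ≠ 0 := by
      intro h0
      rw [sub_eq_zero] at h0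
      have hu : IsUnit B := isCoprime_self.mp (by rw [h0] at hcop; exact hcop.of_mul_left_right)
      have := natDegree_mul_le (p := X) (q := B)
      rw [← h0, natDegree_eq_zero_of_isUnit hu, natDegree_X] at this
      nlinarith
    filter_upwards [hev, eventually_eval_xc_ne_zero hAX] with P ⟨h₁, h₂, h₃⟩ h₄ he
    rw [nsmulAddMonoidHom_apply, AddMonoidHom.id_apply, h₃, div_eq_iff h₂] at he
    exact h₄ (by rw [eval_sub, he, eval_mul, eval_X, sub_self])

/-- Over an algebraically closed field of characteristic zero there are `n ^ 2` points killed
by `n`. -/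
theorem card_ker_nsmul {n : ℕ} (hn : 0 < n) :
    Nat.card (nsmulAddMonoidHom n : W.Point →+ W.Point).ker = n ^ 2 := by
  obtain ⟨A, B, hcop, hA, hB, hev⟩ := exists_actsOnX (W := W) hn
  have hmax : max A.natDegree B.natDegree = n ^ 2 := by omega
  rw [(isRatHom_nsmul hn).card_ker_eq hcop (hev.mono fun P hP => hP.2.2)
    (by rw [hmax]; positivity), hmax]

end Multiplication

/-! ### Finite abelian groups -/

section FiniteGroups

variable {A B G : Type*} [AddCommGroup A] [AddCommGroup B] [AddCommGroup G]

lemma mem_torsionBy_nat {n : ℕ} {x : A} : x ∈ AddSubgroup.torsionBy A (n : ℤ) ↔ n • x = 0 := by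
  rw [← natCast_zsmul]
  rfl

lemma nsmul_eq_zero_of_mem {S : AddSubgroup A} {x : A} (hx : x ∈ S) : Nat.card S • x = 0 :=
  congrArg Subtype.val (card_nsmul_eq_zero' (x := (⟨x, hx⟩ : S)))

lemma card_eq_card_ker_mul_card_map (f : A →+ B) {K : AddSubgroup A} (h : f.ker ≤ K) :
    Nat.card K = Nat.card f.ker * Nat.card (K.map f) := by
  rw [← AddSubgroup.relIndex_ker, AddSubgroup.relIndex,
    ← (f.ker.addSubgroupOf K).card_mul_index,
    Nat.card_congr (AddSubgroup.addSubgroupOfEquivOfLe h).toEquiv]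

lemma card_ker_comp {f : A →+ B} (hf : Function.Surjective f) (g : B →+ G) :
    Nat.card (g.comp f).ker = Nat.card f.ker * Nat.card g.ker := by
  have h : (g.comp f).ker.map f = g.ker := by
    rw [← AddMonoidHom.comap_ker, AddSubgroup.map_comap_eq_self_of_surjective hf]
  rw [card_eq_card_ker_mul_card_map f (K := (g.comp f).ker), h]
  intro x hx
  rw [AddMonoidHom.mem_ker] at hx ⊢
  rw [AddMonoidHom.comp_apply, hx, map_zero]

lemma card_inf_torsionBy_le {C : AddSubgroup A} [IsAddCyclic C] [Finite C] {n : ℕ} (hn : 0 < n) :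
    Nat.card (C ⊓ AddSubgroup.torsionBy A (n : ℤ) : AddSubgroup A) ≤ n := by
  classical
  have := Fintype.ofFinite C
  refine le_trans ?_ (IsAddCyclic.card_nsmul_eq_zero_le (α := C) hn)
  rw [← Nat.card_eq_finsetCard]
  refine Nat.card_le_card_of_injective (fun x => ⟨⟨x.1, x.2.1⟩, ?_⟩) ?_
  · simp only [Finset.mem_filter, Finset.mem_univ, true_and]
    exact Subtype.ext (mem_torsionBy_nat.mp x.2.2)
  · intro x y h
    exact Subtype.ext (congrArg (fun z => z.1.1) h)

/-- A subgroup of a finite cyclic group is determined by its order. -/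
lemma eq_inf_torsionBy_of_le {C S : AddSubgroup A} [IsAddCyclic C] [Finite C] (h : S ≤ C) :
    S = C ⊓ AddSubgroup.torsionBy A (Nat.card S : ℤ) := by
  have hS : Finite S := Finite.of_injective _ (AddSubgroup.inclusion_injective h)
  have : Finite (C ⊓ AddSubgroup.torsionBy A (Nat.card S : ℤ) : AddSubgroup A) :=
    Finite.of_injective _ (AddSubgroup.inclusion_injective inf_le_left)
  exact AddSubgroup.eq_of_le_of_card_ge
    (le_inf h fun x hx => mem_torsionBy_nat.mpr (nsmul_eq_zero_of_mem hx))
    (card_inf_torsionBy_le Nat.card_pos)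

lemma exists_zmultiples_eq {C : AddSubgroup A} [hC : IsAddCyclic C] :
    ∃ c, C = AddSubgroup.zmultiples c := by
  obtain ⟨⟨c, hc⟩, h⟩ := hC.exists_zsmul_surjective
  refine ⟨c, le_antisymm (fun x hx => ?_) (AddSubgroup.zmultiples_le_of_mem hc)⟩
  obtain ⟨n, hn⟩ := h ⟨x, hx⟩
  exact ⟨n, congrArg Subtype.val hn⟩

/-- The sum of two finite cyclic subgroups of coprime orders is cyclic, and its order is the
product of the orders. -/
lemma isAddCyclic_sup_of_coprime {C D : AddSubgroup A} [IsAddCyclic C] [IsAddCyclic D] [Finite C]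
    [Finite D] (h : (Nat.card C).Coprime (Nat.card D)) :
    IsAddCyclic (C ⊔ D : AddSubgroup A) ∧
      Nat.card (C ⊔ D : AddSubgroup A) = Nat.card C * Nat.card D := by
  obtain ⟨c, rfl⟩ := exists_zmultiples_eq (C := C)
  obtain ⟨e, rfl⟩ := exists_zmultiples_eq (C := D)
  have hc : 0 < Nat.card (AddSubgroup.zmultiples c) := Nat.card_pos
  have he : 0 < Nat.card (AddSubgroup.zmultiples e) := Nat.card_pos
  simp only [Nat.card_zmultiples] at h hc he ⊢
  have ho := (AddCommute.all c e).addOrderOf_add_eq_mul_addOrderOf_of_coprime h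
  have hle : AddSubgroup.zmultiples (c + e) ≤
      AddSubgroup.zmultiples c ⊔ AddSubgroup.zmultiples e :=
    AddSubgroup.zmultiples_le_of_mem (AddSubgroup.add_mem_sup
      (AddSubgroup.mem_zmultiples c) (AddSubgroup.mem_zmultiples e))
  -- Both generators are multiples of `c + e` by the Chinese remainder theorem.
  have key : ∀ a b : A, (addOrderOf a).Coprime (addOrderOf b) →
      a ∈ AddSubgroup.zmultiples (a + b) := by
    intro a b hab
    obtain ⟨n, h₁, h₂⟩ := Nat.chineseRemainder hab 1 0
    refine ⟨n, ?_⟩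
    have e₁ : n • a = a := by
      conv_rhs => rw [← one_nsmul a]
      exact nsmul_eq_nsmul_iff_modEq.mpr h₁
    have e₂ : n • b = 0 := by
      rw [← zero_nsmul b]
      exact nsmul_eq_nsmul_iff_modEq.mpr h₂
    change (n : ℤ) • (a + b) = a
    rw [natCast_zsmul, nsmul_add, e₁, e₂, add_zero]
  have heq : AddSubgroup.zmultiples c ⊔ AddSubgroup.zmultiples e =
      AddSubgroup.zmultiples (c + e) := by
    refine le_antisymm (sup_le (AddSubgroup.zmultiples_le_of_mem (key c e h))
      (AddSubgroup.zmultiples_le_of_mem ?_)) hle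
    rw [add_comm]
    exact key e c h.symm
  rw [heq]
  exact ⟨inferInstance, by rw [Nat.card_zmultiples, ho]⟩

/-- A finite abelian group with at most `p` points killed by each prime `p` is cyclic. -/
lemma isAddCyclic_of_card_inf_torsionBy_le {S : AddSubgroup A} [Finite S]
    (h : ∀ p : ℕ, p.Prime → Nat.card (S ⊓ AddSubgroup.torsionBy A (p : ℤ) : AddSubgroup A) ≤ p) :
    IsAddCyclic S := by
  classical
  have := Fintype.ofFinite S
  have hfin : ∀ n : ℤ, Finite (S ⊓ AddSubgroup.torsionBy A n : AddSubgroup A) := fun n =>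
    Finite.of_injective _ (AddSubgroup.inclusion_injective inf_le_left)
  have key : ∀ n : ℕ, n ≠ 0 →
      Nat.card (S ⊓ AddSubgroup.torsionBy A (n : ℤ) : AddSubgroup A) ≤ n := by
    intro n
    induction n using induction_on_primes with
    | zero => intro h; exact absurd rfl h
    | one =>
      intro _
      have : S ⊓ AddSubgroup.torsionBy A ((1 : ℕ) : ℤ) = ⊥ := by
        rw [eq_bot_iff]
        intro x hx
        simpa using mem_torsionBy_nat.mp hx.2
      rw [this]
      simp
    | prime_mul p n hp ih =>
      intro hn
      have hn0 : n ≠ 0 := right_ne_zero_of_mul hn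
      -- Multiplication by `p` maps the points of `S` killed by `p * n` to those killed by `n`.
      set T := S ⊓ AddSubgroup.torsionBy A ((p * n : ℕ) : ℤ) with hT
      set f : T →+ A := (nsmulAddMonoidHom p).comp T.subtype with hf
      have hc := f.ker.card_mul_index
      rw [AddSubgroup.index_ker] at hc
      rw [← hc]
      have : Finite T := hfin _
      refine Nat.mul_le_mul (le_trans ?_ (h p hp)) (le_trans ?_ (ih hn0))
      · have := hfin p
        refine Nat.card_le_card_of_injective (fun x => ⟨x.1.1, x.1.2.1,
          mem_torsionBy_nat.mpr x.2⟩) fun x y hxy => ?_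
        exact Subtype.ext (Subtype.ext (Subtype.mk.inj hxy))
      · have := hfin n
        refine Nat.card_le_card_of_injective (fun x => ⟨x.1, ?_⟩) fun x y hxy => ?_
        · obtain ⟨_, ⟨x, hxS, hxT⟩, rfl⟩ := x
          refine ⟨S.nsmul_mem hxS p, mem_torsionBy_nat.mpr ?_⟩
          change n • p • x = 0
          rw [← mul_nsmul]
          exact mem_torsionBy_nat.mp hxT
        · exact Subtype.ext (Subtype.mk.inj hxy)
  refine isAddCyclic_of_card_nsmul_eq_zero_le fun n hn => le_trans ?_ (key n hn.ne')
  rw [← Nat.card_eq_finsetCard]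
  have := hfin n
  refine Nat.card_le_card_of_injective (fun x => ⟨x.1.1, x.1.2, mem_torsionBy_nat.mpr ?_⟩) ?_
  · have := (Finset.mem_filter.mp x.2).2
    exact congrArg Subtype.val this
  · intro x y hxy
    exact Subtype.ext (Subtype.ext (Subtype.mk.inj hxy))

lemma eq_zero_of_coprime_nsmul {m n : ℕ} (h : m.Coprime n) {x : A} (hm : m • x = 0)
    (hn : n • x = 0) : x = 0 := by
  have h₁ := Nat.dvd_gcd (addOrderOf_dvd_of_nsmul_eq_zero hm) (addOrderOf_dvd_of_nsmul_eq_zero hn)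
  rw [h.gcd_eq_one, Nat.dvd_one, AddMonoid.addOrderOf_eq_one_iff] at h₁
  exact h₁

end FiniteGroups

/-! ### The cyclic isogeny between the targets -/

section CyclicFactor

variable {L : Type*} [Field L] [DecidableEq L] [IsAlgClosed L] [CharZero L]
variable {W W' W₁ W₁' : Affine L} [W.IsElliptic] [W'.IsElliptic] [W₁.IsElliptic] [W₁'.IsElliptic]

lemma card_torsionBy {n : ℕ} (hn : 0 < n) :
    Nat.card (AddSubgroup.torsionBy W.Point (n : ℤ)) = n ^ 2 := by
  rw [← card_ker_nsmul (W := W) hn]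
  congr 2

lemma nsmul_surjective {n : ℕ} (hn : 0 < n) (P : W.Point) : ∃ Q : W.Point, n • Q = P :=
  (isRatHom_nsmul hn).surjective P

lemma eq_zero_of_mem_ker {A B : Type*} [AddCommGroup A] [AddCommGroup B] {f : A →+ B} {n : ℕ}
    (h : (Nat.card f.ker).Coprime n) {x : A} (hx : f x = 0) (hn : n • x = 0) : x = 0 :=
  eq_zero_of_coprime_nsmul h (nsmul_eq_zero_of_mem (S := f.ker) hx) hn

/-- The square formed by an isogeny `μ : W → W'` and cyclic isogenies `φ : W → W₁` and
`φ' : W' → W₁'` of degree `m` prime to that of `μ`: up to multiplication by `k = m / b`, where `b`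
is the order of `ker φ ∩ μ⁻¹(ker φ')`, the composite `φ' ∘ μ` factors through `φ`, and the factor
`W₁ → W₁'` is cyclic of degree `k ^ 2 * d`. -/
theorem exists_cyclic_factor {μ : W.Point →+ W'.Point} {φ : W.Point →+ W₁.Point}
    {φ' : W'.Point →+ W₁'.Point} (hμ : IsRatHom μ) (hφ : IsRatHom φ) (hφ' : IsRatHom φ')
    {d m b k : ℕ} (hd : Nat.card μ.ker = d) (hm : Nat.card φ.ker = m) (hm' : Nat.card φ'.ker = m)
    (hd0 : 0 < d) (hm0 : 0 < m) (hmd : m.Coprime d) [IsAddCyclic μ.ker] [IsAddCyclic φ.ker]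
    [IsAddCyclic φ'.ker]
    (hb : Nat.card (φ.ker ⊓ φ'.ker.comap μ : AddSubgroup W.Point) = b) (hbk : b * k = m) :
    ∃ ν : W₁.Point →+ W₁'.Point, IsRatHom ν ∧ (∀ P, ν (φ P) = k • φ' (μ P)) ∧
      IsAddCyclic ν.ker ∧ Nat.card ν.ker = k ^ 2 * d := by
  have hfin : Finite φ.ker := Nat.finite_of_card_ne_zero (by omega)
  have hfin' : Finite φ'.ker := Nat.finite_of_card_ne_zero (by omega)
  have hfinμ : Finite μ.ker := Nat.finite_of_card_ne_zero (by omega)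
  have hk0 : 0 < k := Nat.pos_of_ne_zero (by rintro rfl; omega)
  have hb0 : 0 < b := Nat.pos_of_ne_zero (by rintro rfl; omega)
  have hB := eq_inf_torsionBy_of_le
    (inf_le_left : φ.ker ⊓ φ'.ker.comap μ ≤ φ.ker)
  rw [hb] at hB
  have hφm : ∀ c, φ c = 0 → m • c = 0 := fun c hc => by
    rw [← hm]; exact nsmul_eq_zero_of_mem (S := φ.ker) hc
  have hφm' : ∀ c, φ' c = 0 → m • c = 0 := fun c hc => by
    rw [← hm']; exact nsmul_eq_zero_of_mem (S := φ'.ker) hc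
  have hψ := ((isRatHom_nsmul hk0).comp hφ').comp hμ
  obtain ⟨ν, hν, hνφ⟩ := hφ.exists_factor hψ (by
    intro c hc
    have h₁ : k • c ∈ φ.ker ⊓ φ'.ker.comap μ := by
      rw [hB]
      refine ⟨φ.ker.nsmul_mem hc k, mem_torsionBy_nat.mpr ?_⟩
      rw [← mul_nsmul, mul_comm, hbk]
      exact hφm c hc
    have h₂ : φ' (μ (k • c)) = 0 := h₁.2
    rw [map_nsmul, map_nsmul] at h₂
    exact h₂)
  have hνφ' : ∀ P, ν (φ P) = k • φ' (μ P) := fun P => DFunLike.congr_fun hνφ P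
  have hcard : Nat.card ν.ker = k ^ 2 * d := by
    have h₁ := card_ker_comp hφ.surjective ν
    rw [hνφ, card_ker_comp hμ.surjective, card_ker_comp hφ'.surjective, card_ker_nsmul hk0, hd, hm,
      hm'] at h₁
    apply Nat.eq_of_mul_eq_mul_left hm0
    rw [← h₁]
    ring
  have hfinν : Finite ν.ker := Nat.finite_of_card_ne_zero (by rw [hcard]; positivity)
  refine ⟨ν, hν, hνφ', isAddCyclic_of_card_inf_torsionBy_le fun p hp => ?_, hcard⟩
  -- Otherwise the kernel contains all points of order `p`.
  by_contra! hlt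
  have hle : AddSubgroup.torsionBy W₁.Point (p : ℤ) ≤ ν.ker := by
    have hcard₁ := card_torsionBy (W := W₁) hp.pos
    have : Finite (AddSubgroup.torsionBy W₁.Point (p : ℤ)) :=
      Nat.finite_of_card_ne_zero (by rw [hcard₁]; exact pow_ne_zero 2 hp.ne_zero)
    have hdvd := AddSubgroup.card_dvd_of_le
      (inf_le_right : ν.ker ⊓ AddSubgroup.torsionBy W₁.Point (p : ℤ) ≤ _)
    rw [hcard₁, Nat.dvd_prime_pow hp] at hdvd
    obtain ⟨i, hi, hi'⟩ := hdvd
    have hi2 : i = 2 := by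
      by_contra hne
      have : i ≤ 1 := by omega
      have := Nat.pow_le_pow_right hp.pos this
      rw [pow_one] at this
      omega
    rw [← inf_eq_right]
    exact AddSubgroup.eq_of_le_of_card_ge inf_le_right (by rw [hcard₁, hi', hi2])
  have hp0 : ∀ Q : W.Point, φ (p • Q) = 0 → k • φ' (μ Q) = 0 := by
    intro Q hQ
    rw [← hνφ']
    exact hle (mem_torsionBy_nat.mpr (by rw [← map_nsmul, hQ]))
  have hcardp := card_torsionBy (W := W) hp.pos
  have hlt2 : p < p ^ 2 := by nlinarith [hp.two_le]
  by_cases hpk : p ∣ k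
  · -- If `p` divides `k`, write a generator of `ker φ` as `p` times a point.
    obtain ⟨l, rfl⟩ := hpk
    obtain ⟨c, hc⟩ := exists_zmultiples_eq (C := φ.ker)
    have hcmem : φ c = 0 := by
      have : c ∈ φ.ker := hc ▸ AddSubgroup.mem_zmultiples c
      exact this
    have hcm : addOrderOf c = m := by rw [← Nat.card_zmultiples, ← hc, hm]
    obtain ⟨Q, hQ⟩ := nsmul_surjective hp.pos c
    have h₁ := hp0 Q (by rw [hQ, hcmem])
    have h₂ : l • c ∈ φ.ker ⊓ φ'.ker.comap μ := by
      refine ⟨φ.ker.nsmul_mem hcmem l, ?_⟩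
      change φ' (μ (l • c)) = 0
      rw [← hQ, ← mul_nsmul, map_nsmul, map_nsmul, h₁]
    rw [hB] at h₂
    have h₃ := mem_torsionBy_nat.mp h₂.2
    rw [← mul_nsmul] at h₃
    have h₄ := addOrderOf_dvd_of_nsmul_eq_zero h₃
    rw [hcm, ← hbk] at h₄
    have hl0 : 0 < l := Nat.pos_of_mul_pos_left hk0
    have h₅ := Nat.le_of_dvd (by positivity) h₄
    have h₆ := hp.two_le
    nlinarith [Nat.mul_pos hb0 hl0]
  · -- Otherwise `ker (φ' ∘ μ)` contains the points killed by `p`.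
    have h₁ : ∀ Q ∈ AddSubgroup.torsionBy W.Point (p : ℤ), φ' (μ Q) = 0 := by
      intro Q hQ
      have hQ := mem_torsionBy_nat.mp hQ
      refine eq_zero_of_coprime_nsmul ((Nat.Prime.coprime_iff_not_dvd hp).mpr hpk) ?_
        (hp0 Q (by rw [hQ, map_zero]))
      rw [← map_nsmul, ← map_nsmul, hQ, map_zero, map_zero]
    by_cases hpd : p ∣ d
    · have hpm : m.Coprime p := hmd.coprime_dvd_right hpd
      have hsub : AddSubgroup.torsionBy W.Point (p : ℤ) ≤
          μ.ker ⊓ AddSubgroup.torsionBy W.Point (p : ℤ) := by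
        intro Q hQ
        refine ⟨eq_zero_of_coprime_nsmul hpm (hφm' _ (h₁ Q hQ)) ?_, hQ⟩
        rw [← map_nsmul, mem_torsionBy_nat.mp hQ, map_zero]
      have h₂ := card_inf_torsionBy_le (C := μ.ker) hp.pos
      rw [← le_antisymm hsub inf_le_right, hcardp] at h₂
      omega
    · have hpd' : d.Coprime p := ((Nat.Prime.coprime_iff_not_dvd hp).mpr hpd).symm
      have h₂ := card_inf_torsionBy_le (C := φ'.ker) hp.pos
      have : Finite (φ'.ker ⊓ AddSubgroup.torsionBy W'.Point (p : ℤ) : AddSubgroup W'.Point) :=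
        Finite.of_injective _ (AddSubgroup.inclusion_injective inf_le_left)
      have h₃ : Nat.card (AddSubgroup.torsionBy W.Point (p : ℤ)) ≤
          Nat.card (φ'.ker ⊓ AddSubgroup.torsionBy W'.Point (p : ℤ) : AddSubgroup W'.Point) := by
        refine Nat.card_le_card_of_injective (fun Q => ⟨μ Q.1, h₁ Q.1 Q.2,
          mem_torsionBy_nat.mpr ?_⟩) fun Q Q' hQQ => ?_
        · rw [← map_nsmul, mem_torsionBy_nat.mp Q.2, map_zero]
        · have hsub : μ (Q.1 - Q'.1) = 0 := by
            rw [map_sub, sub_eq_zero]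
            exact congrArg Subtype.val hQQ
          refine Subtype.ext (sub_eq_zero.mp (eq_zero_of_mem_ker (hd.symm ▸ hpd') hsub ?_))
          rw [nsmul_sub, mem_torsionBy_nat.mp Q.2, mem_torsionBy_nat.mp Q'.2, sub_zero]
      omega

end CyclicFactor

/-! ### Galois conjugation of isogenies -/

section Conjugation

variable {L : Type*} [Field L] [DecidableEq L]
variable {W W' W'' W₁ W₁' W₁'' W₂ W₂' : Affine L}

/-- `conjPoint` with a given model `W'` of the conjugate curve. -/
noncomputable def conjTo (τ : L ≃+* L) (h : W.map (τ : L →+* L) = W') : W.Point ≃+ W'.Point :=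
  h ▸ conjPoint τ W

lemma xc_conjTo (τ : L ≃+* L) (h : W.map (τ : L →+* L) = W') (P : W.Point) :
    xc (conjTo τ h P) = τ (xc P) := by
  subst h
  rcases P with _ | ⟨x, y, hP⟩
  · exact (map_zero τ).symm
  · rfl

lemma yc_conjTo (τ : L ≃+* L) (h : W.map (τ : L →+* L) = W') (P : W.Point) :
    yc (conjTo τ h P) = τ (yc P) := by
  subst h
  rcases P with _ | ⟨x, y, hP⟩
  · exact (map_zero τ).symm
  · rfl

lemma conjTo_conjTo (τ τ' : L ≃+* L) (h : W.map (τ : L →+* L) = W')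
    (h' : W'.map (τ' : L →+* L) = W'') (h'' : W.map ((τ.trans τ' : L ≃+* L) : L →+* L) = W'')
    (P : W.Point) : conjTo τ' h' (conjTo τ h P) = conjTo (τ.trans τ') h'' P := by
  by_cases hP : P = 0
  · rw [hP, map_zero, map_zero, map_zero]
  · refine ext_coords ?_ ?_ ?_ ?_
    · simpa using hP
    · simpa using hP
    · simp only [xc_conjTo, RingEquiv.trans_apply]
    · simp only [yc_conjTo, RingEquiv.trans_apply]

lemma map_trans_eq {L : Type*} [Field L] {W W' W'' : Affine L} {τ τ' : L ≃+* L}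
    (h : W.map (τ : L →+* L) = W')
    (h' : W'.map (τ' : L →+* L) = W'') :
    W.map ((τ.trans τ' : L ≃+* L) : L →+* L) = W'' := by
  subst h h'
  rfl

lemma conjTo_refl (h : W.map ((RingEquiv.refl L : L ≃+* L) : L →+* L) = W) (P : W.Point) :
    conjTo (RingEquiv.refl L) h P = P := by
  by_cases hP : P = 0
  · rw [hP, map_zero]
  · refine ext_coords ?_ hP ?_ ?_
    · simpa using hP
    · rw [xc_conjTo]; rfl
    · rw [yc_conjTo]; rfl

/-- The conjugate of a homomorphism between groups of points. -/
noncomputable def conjHom (τ : L ≃+* L) (h : W.map (τ : L →+* L) = W')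
    (h₁ : W₁.map (τ : L →+* L) = W₁') (f : W.Point →+ W₁.Point) : W'.Point →+ W₁'.Point :=
  ((conjTo τ h₁).toAddMonoidHom.comp f).comp (conjTo τ h).symm.toAddMonoidHom

lemma conjHom_conjTo (τ : L ≃+* L) (h : W.map (τ : L →+* L) = W')
    (h₁ : W₁.map (τ : L →+* L) = W₁') (f : W.Point →+ W₁.Point) (P : W.Point) :
    conjHom τ h h₁ f (conjTo τ h P) = conjTo τ h₁ (f P) := by
  change conjTo τ h₁ (f ((conjTo τ h).symm (conjTo τ h P))) = _
  rw [AddEquiv.symm_apply_apply]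

lemma conjHom_comp (τ : L ≃+* L) (h : W.map (τ : L →+* L) = W')
    (h₁ : W₁.map (τ : L →+* L) = W₁') (h₂ : W₂.map (τ : L →+* L) = W₂')
    (f : W.Point →+ W₁.Point) (g : W₁.Point →+ W₂.Point) (P : W'.Point) :
    conjHom τ h₁ h₂ g (conjHom τ h h₁ f P) = conjHom τ h h₂ (g.comp f) P := by
  obtain ⟨P, rfl⟩ := (conjTo τ h).surjective P
  rw [conjHom_conjTo, conjHom_conjTo, conjHom_conjTo]
  rfl

lemma conjHom_nsmul_comp (τ : L ≃+* L) (h : W.map (τ : L →+* L) = W')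
    (h₁ : W₁.map (τ : L →+* L) = W₁') (h₂ : W₂.map (τ : L →+* L) = W₂') {k : ℕ}
    {f : W.Point →+ W₁.Point} {g : W₁.Point →+ W₂.Point} {e : W.Point →+ W₂.Point}
    (hfg : ∀ P, e P = k • g (f P)) (P : W'.Point) :
    conjHom τ h h₂ e P = k • conjHom τ h₁ h₂ g (conjHom τ h h₁ f P) := by
  obtain ⟨P, rfl⟩ := (conjTo τ h).surjective P
  rw [conjHom_conjTo, conjHom_conjTo, conjHom_conjTo, hfg, map_nsmul]

lemma ker_conjHom (τ : L ≃+* L) (h : W.map (τ : L →+* L) = W')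
    (h₁ : W₁.map (τ : L →+* L) = W₁') (f : W.Point →+ W₁.Point) :
    (conjHom τ h h₁ f).ker = f.ker.map (conjTo τ h).toAddMonoidHom := by
  ext P
  obtain ⟨P, rfl⟩ := (conjTo τ h).surjective P
  rw [AddMonoidHom.mem_ker, conjHom_conjTo, map_eq_zero_iff _ (conjTo τ h₁).injective]
  constructor
  · exact fun hP => ⟨P, hP, rfl⟩
  · rintro ⟨Q, hQ, hQP⟩
    obtain rfl := (conjTo τ h).injective hQP
    exact hQ

lemma card_map_conjTo (τ : L ≃+* L) (h : W.map (τ : L →+* L) = W') (C : AddSubgroup W.Point) :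
    Nat.card (C.map (conjTo τ h).toAddMonoidHom) = Nat.card C :=
  (Nat.card_congr ((conjTo τ h).addSubgroupMap C).toEquiv).symm

lemma isAddCyclic_map_conjTo (τ : L ≃+* L) (h : W.map (τ : L →+* L) = W')
    (C : AddSubgroup W.Point) [IsAddCyclic C] :
    IsAddCyclic (C.map (conjTo τ h).toAddMonoidHom) :=
  isAddCyclic_of_surjective ((conjTo τ h).addSubgroupMap C)
    ((conjTo τ h).addSubgroupMap C).surjective

lemma IsRatHom.conjHom [W.IsElliptic] {f : W.Point →+ W₁.Point} (hf : IsRatHom f) (τ : L ≃+* L)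
    (h : W.map (τ : L →+* L) = W') (h₁ : W₁.map (τ : L →+* L) = W₁') :
    IsRatHom (conjHom τ h h₁ f) := by
  subst h h₁
  obtain ⟨φ, rfl⟩ := hf.exists_isogeny
  exact (φ.conj τ).isRatHom

lemma aevalAeval_apply_ringEquiv {L : Type*} [Field L] {k : Type*} [Field k] [Algebra k L]
    (τ : L ≃+* L) (p : k[X][Y])
    (x y : L) : τ (aevalAeval x y p) = aevalAeval (τ x) (τ y)
      (p.map (mapRingHom ((τ : L →+* L).comp (algebraMap k L)))) := by
  rw [← aevalAeval_map_algebraMap, ← aevalAeval_conj, Polynomial.map_map, mapRingHom_comp]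

/-- The conjugates of an isogeny over `k` by two automorphisms that agree on `k` coincide. -/
lemma conjHom_eq_of_eqOn [IsAlgClosed L] [W'.IsElliptic] {k : Type*} [Field k] [Algebra k L]
    (φ : Isogeny k W W₁) {τ τ' : L ≃+* L}
    (hτ : ∀ a : k, τ (algebraMap k L a) = τ' (algebraMap k L a))
    (h : W.map (τ : L →+* L) = W') (h₁ : W₁.map (τ : L →+* L) = W₁')
    (h' : W.map (τ' : L →+* L) = W') (h₁' : W₁.map (τ' : L →+* L) = W₁') :
    conjHom τ h h₁ φ.hom = conjHom τ' h' h₁' φ.hom := by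
  obtain ⟨f, g, q, hfgq⟩ := φ.eventually_rational
  have hρ : (τ : L →+* L).comp (algebraMap k L) = (τ' : L →+* L).comp (algebraMap k L) :=
    RingHom.ext hτ
  refine hom_eq_of_eventually_eq ?_
  filter_upwards [((conjTo τ h).symm.injective.tendsto_cofinite).eventually hfgq,
    ((conjTo τ' h').symm.injective.tendsto_cofinite).eventually hfgq] with Q h₂ h₃
  obtain ⟨P, rfl⟩ := (conjTo τ h).surjective Q
  obtain ⟨P', hP'⟩ := (conjTo τ' h').surjective (conjTo τ h P)
  rw [AddEquiv.symm_apply_apply] at h₂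
  rw [← hP', AddEquiv.symm_apply_apply] at h₃
  rw [conjHom_conjTo, ← hP', conjHom_conjTo]
  have ex : τ (xc P) = τ' (xc P') := by rw [← xc_conjTo τ h, ← xc_conjTo τ' h', hP']
  have ey : τ (yc P) = τ' (yc P') := by rw [← yc_conjTo τ h, ← yc_conjTo τ' h', hP']
  refine ext_coords ?_ ?_ ?_ ?_
  · simpa using h₂.2.1
  · simpa using h₃.2.1
  · rw [xc_conjTo, xc_conjTo, h₂.2.2.1, h₃.2.2.1, map_div₀, map_div₀]
    simp only [aevalAeval_apply_ringEquiv, hρ, ex, ey]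
  · rw [yc_conjTo, yc_conjTo, h₂.2.2.2, h₃.2.2.2, map_div₀, map_div₀]
    simp only [aevalAeval_apply_ringEquiv, hρ, ex, ey]

lemma conjHom_conjHom (τ τ' : L ≃+* L) (h : W.map (τ : L →+* L) = W')
    (h' : W'.map (τ' : L →+* L) = W'') (h'' : W.map ((τ.trans τ' : L ≃+* L) : L →+* L) = W'')
    (h₁ : W₁.map (τ : L →+* L) = W₁') (h₁' : W₁'.map (τ' : L →+* L) = W₁'')
    (h₁'' : W₁.map ((τ.trans τ' : L ≃+* L) : L →+* L) = W₁'') (f : W.Point →+ W₁.Point) :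
    conjHom τ' h' h₁' (conjHom τ h h₁ f) = conjHom (τ.trans τ') h'' h₁'' f := by
  ext P
  obtain ⟨P, rfl⟩ := (conjTo (τ.trans τ') h'').surjective P
  rw [conjHom_conjTo, ← conjTo_conjTo τ τ' h h', conjHom_conjTo, conjHom_conjTo,
    conjTo_conjTo τ τ' h₁ h₁' h₁'']

lemma conjHom_refl (h : W.map ((RingEquiv.refl L : L ≃+* L) : L →+* L) = W)
    (h₁ : W₁.map ((RingEquiv.refl L : L ≃+* L) : L →+* L) = W₁) (f : W.Point →+ W₁.Point) :
    conjHom (RingEquiv.refl L) h h₁ f = f := by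
  ext P
  obtain ⟨P, rfl⟩ := (conjTo (RingEquiv.refl L) h).surjective P
  rw [conjHom_conjTo, conjTo_refl, conjTo_refl]

end Conjugation

/-! ### Isogenies between conjugate curves without complex multiplication -/

section NoCM

variable {L : Type*} [Field L] [DecidableEq L] [IsAlgClosed L] [CharZero L]
variable {W W' : Affine L} [W.IsElliptic] [W'.IsElliptic]

/-- Without complex multiplication, isogenies of degree `d` in opposite directions compose to
multiplication by `±d`. -/
lemma comp_eq_or_eq_neg
    (hCM : ∀ f : W.Point →+ W.Point, IsRatHom f → ∃ n : ℤ, ∀ P, f P = n • P)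
    {μ : W.Point →+ W'.Point} {μ' : W'.Point →+ W.Point} (hμ : IsRatHom μ) (hμ' : IsRatHom μ')
    {d : ℕ} (hd : Nat.card μ.ker = d) (hd' : Nat.card μ'.ker = d) :
    (∀ P, μ' (μ P) = d • P) ∨ ∀ P, μ' (μ P) = -(d • P) := by
  obtain ⟨n, hn⟩ := hCM _ (hμ'.comp hμ)
  have hn' : ∀ P, μ' (μ P) = n • P := hn
  have hker : (μ'.comp μ).ker = (nsmulAddMonoidHom n.natAbs : W.Point →+ W.Point).ker := by
    ext P
    rw [AddMonoidHom.mem_ker, AddMonoidHom.mem_ker, hn, nsmulAddMonoidHom_apply]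
    rcases Int.natAbs_eq n with h | h
    · conv_lhs => rw [h, natCast_zsmul]
    · conv_lhs => rw [h, neg_zsmul, natCast_zsmul, neg_eq_zero]
  have hcard := card_ker_comp hμ.surjective μ'
  rw [hker, hd, hd'] at hcard
  have hn0 : 0 < n.natAbs := by
    by_contra! h0
    have h0 : n = 0 := by omega
    have := infinite_point (W := W)
    have hfin := (hμ'.comp hμ).finite_ker
    refine Set.infinite_univ (hfin.subset fun P _ => ?_)
    change μ' (μ P) = 0
    rw [hn', h0, zero_zsmul]
  rw [card_ker_nsmul hn0, ← sq] at hcard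
  have hnd : n.natAbs = d := Nat.pow_left_injective two_ne_zero hcard
  rcases Int.natAbs_eq n with h | h
  · left
    intro P
    rw [hn', h, hnd, natCast_zsmul]
  · right
    intro P
    rw [hn', h, hnd, neg_zsmul, natCast_zsmul]

/-- A homomorphism from a group of points is determined by its composite with one of finite
kernel, because the group of points is divisible. -/
lemma eq_zero_of_comp_eq_zero {A B : Type*} [AddCommGroup A] [AddCommGroup B] {δ : W.Point →+ A}
    {g : A →+ B} (hg : 0 < Nat.card g.ker) (h : ∀ P, g (δ P) = 0) (P : W.Point) : δ P = 0 := by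
  obtain ⟨Q, rfl⟩ := nsmul_surjective hg P
  rw [map_nsmul]
  exact nsmul_eq_zero_of_mem (S := g.ker) (h Q)

/-- Without complex multiplication, isogenies of equal degree to a curve that has an isogeny of
that degree back agree up to sign. -/
lemma eq_or_eq_neg_of_card_ker_eq
    (hCM : ∀ f : W.Point →+ W.Point, IsRatHom f → ∃ n : ℤ, ∀ P, f P = n • P)
    {μ ρ : W.Point →+ W'.Point} {μ' : W'.Point →+ W.Point} (hμ : IsRatHom μ) (hρ : IsRatHom ρ)
    (hμ' : IsRatHom μ') {d : ℕ} (hd : Nat.card μ.ker = d) (hdρ : Nat.card ρ.ker = d)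
    (hd' : Nat.card μ'.ker = d) (hd0 : 0 < d) : (∀ P, ρ P = μ P) ∨ ∀ P, ρ P = -μ P := by
  have hpos : 0 < Nat.card μ'.ker := by omega
  have hsub : (∀ P, μ' (ρ P) = μ' (μ P)) → ∀ P, ρ P = μ P := fun h P => by
    have := eq_zero_of_comp_eq_zero (δ := ρ - μ) hpos (fun P => by
      rw [AddMonoidHom.sub_apply, map_sub, h, sub_self]) P
    rwa [AddMonoidHom.sub_apply, sub_eq_zero] at this
  have hadd : (∀ P, μ' (ρ P) = -μ' (μ P)) → ∀ P, ρ P = -μ P := fun h P => by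
    have := eq_zero_of_comp_eq_zero (δ := ρ + μ) hpos (fun P => by
      rw [AddMonoidHom.add_apply, map_add, h, neg_add_cancel]) P
    rwa [AddMonoidHom.add_apply, add_eq_zero_iff_eq_neg] at this
  rcases comp_eq_or_eq_neg hCM hμ hμ' hd hd' with h | h <;>
    rcases comp_eq_or_eq_neg hCM hρ hμ' hdρ hd' with h' | h'
  · exact Or.inl (hsub fun P => by rw [h, h'])
  · exact Or.inr (hadd fun P => by rw [h, h'])
  · exact Or.inr (hadd fun P => by rw [h, h', neg_neg])
  · exact Or.inl (hsub fun P => by rw [h, h'])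

lemma ker_eq_of_eq_or_eq_neg {A B : Type*} [AddCommGroup A] [AddCommGroup B] {f g : A →+ B}
    (h : (∀ P, f P = g P) ∨ ∀ P, f P = -g P) : f.ker = g.ker := by
  ext P
  rw [AddMonoidHom.mem_ker, AddMonoidHom.mem_ker]
  rcases h with h | h <;> simp [h P]

lemma ker_eq_map_torsionBy {A B : Type*} [AddCommGroup A] [AddCommGroup B] {f : A →+ B}
    {g : B →+ A} (hf : Function.Surjective f) {n : ℕ}
    (h : (∀ P, g (f P) = n • P) ∨ ∀ P, g (f P) = -(n • P)) :
    g.ker = (AddSubgroup.torsionBy A (n : ℤ)).map f := by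
  ext Q
  obtain ⟨P, rfl⟩ := hf Q
  have key : ∀ P, g (f P) = 0 ↔ n • P = 0 := fun P => by rcases h with h | h <;> simp [h P]
  rw [AddMonoidHom.mem_ker, key]
  constructor
  · exact fun hP => ⟨P, mem_torsionBy_nat.mpr hP, rfl⟩
  · rintro ⟨P', hP', he⟩
    rw [← key, ← he, key]
    exact mem_torsionBy_nat.mp hP'

end NoCM

/-! ### Rational points of the quotients of modular curves -/

section ModularCurves

variable {n : ℕ}

/-- The conjugate of `x`, on a given model of the conjugate curve. -/
noncomputable def Enhanced.conjTo (x : Enhanced n) (τ : QBar ≃ₐ[ℚ] QBar) {W' : Affine QBar}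
    (h : x.W.map ((τ : QBar ≃+* QBar) : QBar →+* QBar) = W') : Enhanced n where
  W := W'
  isElliptic := h ▸ inferInstance
  C := x.C.map (EllCurve.conjTo (τ : QBar ≃+* QBar) h).toAddMonoidHom
  isAddCyclic := isAddCyclic_map_conjTo _ h x.C
  card_eq := (card_map_conjTo _ h x.C).trans x.card_eq

lemma Enhanced.conj_eq_conjTo (x : Enhanced n) (τ : QBar ≃ₐ[ℚ] QBar) {W' : Affine QBar}
    (h : x.W.map ((τ : QBar ≃+* QBar) : QBar →+* QBar) = W') : x.conj τ = x.conjTo τ h := by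
  subst h
  rfl

lemma Y0ModW.conj_mk_of_map_eq (d : ℕ) (x : Enhanced n) (τ : QBar ≃ₐ[ℚ] QBar)
    (h : x.W.map ((τ : QBar ≃+* QBar) : QBar →+* QBar) = x.W)
    (hC : x.C.map (conjTo (τ : QBar ≃+* QBar) h).toAddMonoidHom = x.C) :
    (Y0ModW.mk d x).conj τ = Y0ModW.mk d x := by
  change Y0ModW.mk d (x.conj τ) = _
  rw [x.conj_eq_conjTo τ h]
  congr 1
  obtain ⟨W, hW, C, hcyc, hcard⟩ := x
  simp only [Enhanced.conjTo, Enhanced.mk.injEq, heq_eq_eq, true_and]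
  exact hC

lemma Y0ModW.conj_mk_of_atkinLehner (d : ℕ) (x : Enhanced n) (τ : QBar ≃ₐ[ℚ] QBar)
    {W' : Affine QBar} (h : x.W.map ((τ : QBar ≃+* QBar) : QBar →+* QBar) = W')
    {μ : x.W.Point →+ W'.Point} (hμ : IsRatHom μ)
    (hker : μ.ker = x.C ⊓ AddSubgroup.torsionBy x.W.Point (d : ℤ))
    (hC : x.C.map (conjTo (τ : QBar ≃+* QBar) h).toAddMonoidHom =
      (AddSubgroup.torsionBy x.W.Point (d : ℤ) ⊔ x.C).map μ) :
    (Y0ModW.mk d x).conj τ = Y0ModW.mk d x := by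
  change Y0ModW.mk d (x.conj τ) = _
  rw [x.conj_eq_conjTo τ h]
  obtain ⟨φ, rfl⟩ := hμ.exists_isogeny
  exact (Quot.sound ⟨x, x.conjTo τ h, rfl, rfl, φ, hker, hC⟩).symm

end ModularCurves

/-! ### Rational points from isogenies between conjugate curves -/

section RationalPoints

variable {W W' W₁ W₁' : Affine QBar} [W.IsElliptic] [W'.IsElliptic] [W₁.IsElliptic]
  [W₁'.IsElliptic]

/-- A cyclic isogeny `ν : W₁ → W₁'` of degree `n` gives a rational point of `X_0^+(n)`, if `W₁'` is
the conjugate of `W₁` and, up to sign, the conjugates of `ν` are `ν` itself or dual to `ν`. -/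
lemma isRational_of_isAddCyclic_ker {n : ℕ} {ν : W₁.Point →+ W₁'.Point} (hν : IsRatHom ν)
    [IsAddCyclic ν.ker] (hn : Nat.card ν.ker = n)
    (hGal : ∀ τ : QBar ≃ₐ[ℚ] QBar,
      (∃ (h : W₁.map ((τ : QBar ≃+* QBar) : QBar →+* QBar) = W₁)
        (h' : W₁'.map ((τ : QBar ≃+* QBar) : QBar →+* QBar) = W₁'),
        (∀ P, conjHom _ h h' ν P = ν P) ∨ ∀ P, conjHom _ h h' ν P = -ν P) ∨
      (∃ (h : W₁.map ((τ : QBar ≃+* QBar) : QBar →+* QBar) = W₁')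
        (h' : W₁'.map ((τ : QBar ≃+* QBar) : QBar →+* QBar) = W₁),
        (∀ P, conjHom _ h h' ν (ν P) = n • P) ∨ ∀ P, conjHom _ h h' ν (ν P) = -(n • P))) :
    ∃ x : Enhanced n, x.W = W₁ ∧ (Y0ModW.mk n x).IsRational := by
  have hle : ν.ker ≤ AddSubgroup.torsionBy W₁.Point (n : ℤ) := fun P hP =>
    mem_torsionBy_nat.mpr (hn ▸ nsmul_eq_zero_of_mem hP)
  let x : Enhanced n := ⟨W₁, inferInstance, ν.ker, inferInstance, hn⟩
  refine ⟨x, rfl, fun τ => ?_⟩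
  rcases hGal τ with ⟨h, h', hτ⟩ | ⟨h, h', hτ⟩
  · refine Y0ModW.conj_mk_of_map_eq n x τ h ?_
    change ν.ker.map _ = ν.ker
    rw [← ker_conjHom _ h h', ker_eq_of_eq_or_eq_neg hτ]
  · refine Y0ModW.conj_mk_of_atkinLehner n x τ h hν (inf_eq_left.mpr hle).symm ?_
    change ν.ker.map _ = (_ ⊔ ν.ker).map ν
    rw [← ker_conjHom _ h h', ker_eq_map_torsionBy hν.surjective hτ, sup_eq_left.mpr hle]

/-- A cyclic isogeny `μ : W → W'` of degree `d` and a cyclic subgroup `B` of `W` of order `b` prime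
to `d` give a rational point of `X_0(b * d) / w_d`, if `W'` is the conjugate of `W`, the conjugates
of `B` are `B` and `μ(B)`, and, up to sign, the conjugates of `μ` are `μ` itself or dual to `μ`. -/
lemma isRational_sup {d b : ℕ} {μ : W.Point →+ W'.Point} (hμ : IsRatHom μ)
    [IsAddCyclic μ.ker] (hd : Nat.card μ.ker = d) (hd0 : 0 < d) {B : AddSubgroup W.Point}
    [IsAddCyclic B] (hb : Nat.card B = b) (hb0 : 0 < b) (hbd : b.Coprime d)
    (hGal : ∀ τ : QBar ≃ₐ[ℚ] QBar,
      (∃ (h : W.map ((τ : QBar ≃+* QBar) : QBar →+* QBar) = W)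
        (h' : W'.map ((τ : QBar ≃+* QBar) : QBar →+* QBar) = W'),
        B.map (conjTo _ h).toAddMonoidHom = B ∧
        ((∀ P, conjHom _ h h' μ P = μ P) ∨ ∀ P, conjHom _ h h' μ P = -μ P)) ∨
      (∃ (h : W.map ((τ : QBar ≃+* QBar) : QBar →+* QBar) = W')
        (h' : W'.map ((τ : QBar ≃+* QBar) : QBar →+* QBar) = W),
        B.map (conjTo _ h).toAddMonoidHom = B.map μ ∧
        ((∀ P, conjHom _ h h' μ (μ P) = d • P) ∨ ∀ P, conjHom _ h h' μ (μ P) = -(d • P)))) :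
    ∃ x : Enhanced (b * d), x.W = W ∧ (Y0ModW.mk d x).IsRational := by
  have : Finite μ.ker := Nat.finite_of_card_ne_zero (by omega)
  have : Finite B := Nat.finite_of_card_ne_zero (by omega)
  obtain ⟨hcyc, hcard⟩ := isAddCyclic_sup_of_coprime (C := B) (D := μ.ker) (by rwa [hb, hd])
  have hle : μ.ker ≤ AddSubgroup.torsionBy W.Point (d : ℤ) := fun P hP =>
    mem_torsionBy_nat.mpr (hd ▸ nsmul_eq_zero_of_mem hP)
  let x : Enhanced (b * d) := ⟨W, inferInstance, B ⊔ μ.ker, hcyc, by rw [hcard, hb, hd]⟩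
  refine ⟨x, rfl, fun τ => ?_⟩
  rcases hGal τ with ⟨h, h', hB, hτ⟩ | ⟨h, h', hB, hτ⟩
  · refine Y0ModW.conj_mk_of_map_eq d x τ h ?_
    change (B ⊔ μ.ker).map _ = B ⊔ μ.ker
    rw [AddSubgroup.map_sup, hB, ← ker_conjHom _ h h', ker_eq_of_eq_or_eq_neg hτ]
  · refine Y0ModW.conj_mk_of_atkinLehner d x τ h hμ ?_ ?_
    · change μ.ker = (B ⊔ μ.ker) ⊓ _
      refine le_antisymm (le_inf le_sup_right hle) ?_
      rintro P ⟨hP, hPd⟩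
      obtain ⟨β, hβ, δ, hδ, rfl⟩ := AddSubgroup.mem_sup.mp hP
      have hdβ : d • β = 0 := by
        have := mem_torsionBy_nat.mp hPd
        rwa [nsmul_add, mem_torsionBy_nat.mp (hle hδ), add_zero] at this
      have hβ0 : β = 0 := eq_zero_of_coprime_nsmul hbd (hb ▸ nsmul_eq_zero_of_mem hβ) hdβ
      rw [hβ0, zero_add]
      exact hδ
    · change (B ⊔ μ.ker).map _ = (_ ⊔ (B ⊔ μ.ker)).map μ
      rw [AddSubgroup.map_sup, hB, ← ker_conjHom _ h h', ker_eq_map_torsionBy hμ.surjective hτ,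
        sup_comm B μ.ker, ← sup_assoc, sup_eq_left.mpr hle, AddSubgroup.map_sup, sup_comm]

/-- Given a cyclic isogeny `μ : W → W'` between conjugate curves and a cyclic isogeny
`φ : W → W₁` over `K` of degree prime to that of `μ`, there are rational points on the two
quotients of modular curves. -/
theorem exists_rational_points {K : IntermediateField ℚ QBar} {σ : K ≃ₐ[ℚ] K}
    (hσ : ∀ a, σ (σ a) = a)
    (hfix : ∀ τ : QBar ≃ₐ[ℚ] QBar, (∀ a : K, τ (algebraMap K QBar a) = algebraMap K QBar a) →
      W.map ((τ : QBar ≃+* QBar) : QBar →+* QBar) = W ∧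
      W'.map ((τ : QBar ≃+* QBar) : QBar →+* QBar) = W' ∧
      W₁.map ((τ : QBar ≃+* QBar) : QBar →+* QBar) = W₁ ∧
      W₁'.map ((τ : QBar ≃+* QBar) : QBar →+* QBar) = W₁')
    (hswap : ∀ τ : QBar ≃ₐ[ℚ] QBar, (∀ a : K, τ (algebraMap K QBar a) = algebraMap K QBar (σ a)) →
      W.map ((τ : QBar ≃+* QBar) : QBar →+* QBar) = W' ∧
      W'.map ((τ : QBar ≃+* QBar) : QBar →+* QBar) = W ∧
      W₁.map ((τ : QBar ≃+* QBar) : QBar →+* QBar) = W₁' ∧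
      W₁'.map ((τ : QBar ≃+* QBar) : QBar →+* QBar) = W₁)
    (hτ : ∀ τ : QBar ≃ₐ[ℚ] QBar, (∀ a : K, τ (algebraMap K QBar a) = algebraMap K QBar a) ∨
      ∀ a : K, τ (algebraMap K QBar a) = algebraMap K QBar (σ a))
    {τ₀ : QBar ≃ₐ[ℚ] QBar} (hτ₀ : ∀ a : K, τ₀ (algebraMap K QBar a) = algebraMap K QBar (σ a))
    (hCM : ∀ f : W.Point →+ W.Point, IsRatHom f → ∃ n : ℤ, ∀ P, f P = n • P)
    {μ : W.Point →+ W'.Point} (hμ : IsRatHom μ) [IsAddCyclic μ.ker] {d : ℕ}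
    (hd : Nat.card μ.ker = d) (hd0 : 0 < d) (φ : Isogeny K W W₁) {m : ℕ}
    (hφ : φ.IsCyclicOfDegree m) (hm0 : 0 < m) (hmd : m.Coprime d) :
    ∃ k : ℕ, k ∣ m ∧ (∃ x : Enhanced (m / k * d), x.W = W ∧ (Y0ModW.mk d x).IsRational) ∧
      ∃ x : Enhanced (k ^ 2 * d), x.W = W₁ ∧ (Y0ModW.mk (k ^ 2 * d) x).IsRational := by
  obtain ⟨hφcyc, hφm⟩ := hφ
  have hφr := φ.isRatHom
  have hfinφ : Finite φ.hom.ker := Nat.finite_of_card_ne_zero (by omega)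
  obtain ⟨h₀, h₀', h₁, h₁'⟩ := hswap τ₀ hτ₀
  -- The conjugate of `φ`, and its own conjugates.
  set φ' := conjHom _ h₀ h₁ φ.hom with hφ'
  have hφ'r : IsRatHom φ' := hφr.conjHom _ h₀ h₁
  have hφ'm : Nat.card φ'.ker = m := by rw [hφ', ker_conjHom, card_map_conjTo, hφm]
  have hφ'cyc : IsAddCyclic φ'.ker := by
    rw [hφ', ker_conjHom]
    exact isAddCyclic_map_conjTo _ h₀ _
  have hfinφ' : Finite φ'.ker := Nat.finite_of_card_ne_zero (by omega)
  have hid : ∀ V : Affine QBar, V.map ((RingEquiv.refl QBar : QBar ≃+* QBar) : QBar →+* QBar) = V :=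
    fun V => V.map_id
  have φ_fix : ∀ τ : QBar ≃ₐ[ℚ] QBar, (∀ a : K, τ (algebraMap K QBar a) = algebraMap K QBar a) →
      ∀ h h₁, conjHom (τ : QBar ≃+* QBar) h h₁ φ.hom = φ.hom := fun τ hτ h h₁ =>
    (conjHom_eq_of_eqOn φ (τ' := RingEquiv.refl QBar) hτ h h₁ (hid W) (hid W₁)).trans
      (conjHom_refl _ _ _)
  have φ_swap : ∀ τ : QBar ≃ₐ[ℚ] QBar,
      (∀ a : K, τ (algebraMap K QBar a) = algebraMap K QBar (σ a)) →
      ∀ h h₁, conjHom (τ : QBar ≃+* QBar) h h₁ φ.hom = φ' := fun τ hτ h h₁ =>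
    conjHom_eq_of_eqOn φ (fun a => (hτ a).trans (hτ₀ a).symm) h h₁ h₀ _
  have φ'_fix : ∀ τ : QBar ≃ₐ[ℚ] QBar, (∀ a : K, τ (algebraMap K QBar a) = algebraMap K QBar a) →
      ∀ h h₁, conjHom (τ : QBar ≃+* QBar) h h₁ φ' = φ' := fun τ hτ h h₂ => by
    rw [hφ', conjHom_conjHom _ _ h₀ h (map_trans_eq h₀ h) h₁ h₂ (map_trans_eq h₁ h₂)]
    refine conjHom_eq_of_eqOn φ (fun a => ?_) _ _ h₀ h₁
    change τ (τ₀ (algebraMap K QBar a)) = τ₀ (algebraMap K QBar a)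
    rw [hτ₀, hτ]
  have φ'_swap : ∀ τ : QBar ≃ₐ[ℚ] QBar,
      (∀ a : K, τ (algebraMap K QBar a) = algebraMap K QBar (σ a)) →
      ∀ h h₁, conjHom (τ : QBar ≃+* QBar) h h₁ φ' = φ.hom := fun τ hτ h h₂ => by
    rw [hφ', conjHom_conjHom _ _ h₀ h (map_trans_eq h₀ h) h₁ h₂ (map_trans_eq h₁ h₂)]
    refine (conjHom_eq_of_eqOn φ (τ' := RingEquiv.refl QBar) (fun a => ?_) _ _ (hid W)
      (hid W₁)).trans (conjHom_refl _ _ _)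
    change τ (τ₀ (algebraMap K QBar a)) = algebraMap K QBar a
    rw [hτ₀, hτ, hσ]
  -- The conjugates of `μ`.
  have card_conj : ∀ (τ : QBar ≃+* QBar) {V V' : Affine QBar} (h : W.map (τ : QBar →+* QBar) = V)
      (h' : W'.map (τ : QBar →+* QBar) = V'), Nat.card (conjHom τ h h' μ).ker = d :=
    fun τ V V' h h' => by rw [ker_conjHom, card_map_conjTo, hd]
  have μ_fix : ∀ τ : QBar ≃ₐ[ℚ] QBar, (∀ a : K, τ (algebraMap K QBar a) = algebraMap K QBar a) →
      ∀ h h', (∀ P, conjHom (τ : QBar ≃+* QBar) h h' μ P = μ P) ∨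
        ∀ P, conjHom (τ : QBar ≃+* QBar) h h' μ P = -μ P := fun τ _ h h' =>
    eq_or_eq_neg_of_card_ker_eq hCM hμ (hμ.conjHom _ h h') (hμ.conjHom _ h₀ h₀') hd
      (card_conj _ h h') (card_conj _ h₀ h₀') hd0
  have μ_swap : ∀ τ : QBar ≃ₐ[ℚ] QBar,
      (∀ a : K, τ (algebraMap K QBar a) = algebraMap K QBar (σ a)) →
      ∀ h h', (∀ P, conjHom (τ : QBar ≃+* QBar) h h' μ (μ P) = d • P) ∨
        ∀ P, conjHom (τ : QBar ≃+* QBar) h h' μ (μ P) = -(d • P) := fun τ _ h h' =>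
    comp_eq_or_eq_neg hCM hμ (hμ.conjHom _ h h') hd (card_conj _ h h')
  -- The subgroup `B` of `ker φ` that `μ` maps into the conjugate of `ker φ`.
  set B := φ.hom.ker ⊓ φ'.ker.comap μ with hB
  have hfinB : Finite B := Finite.of_injective _
    (AddSubgroup.inclusion_injective (inf_le_left : B ≤ φ.hom.ker))
  have hBcyc : IsAddCyclic B := isAddCyclic_of_injective
    (AddSubgroup.inclusion (inf_le_left : B ≤ φ.hom.ker)) (AddSubgroup.inclusion_injective _)
  have hB0 : 0 < Nat.card B := Nat.card_pos
  obtain ⟨k, hk⟩ : Nat.card B ∣ m :=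
    hφm ▸ AddSubgroup.card_dvd_of_le (inf_le_left : B ≤ φ.hom.ker)
  have hk0 : 0 < k := Nat.pos_of_ne_zero (by rintro rfl; omega)
  have hmk : m / k = Nat.card B := by rw [hk, Nat.mul_div_cancel _ hk0]
  have hBd : (Nat.card B).Coprime d := hmd.coprime_dvd_left (Dvd.intro _ hk.symm)
  have hB₁ : B = φ.hom.ker ⊓ AddSubgroup.torsionBy W.Point (Nat.card B : ℤ) :=
    eq_inf_torsionBy_of_le inf_le_left
  have hB₂ : B.map μ = φ'.ker ⊓ AddSubgroup.torsionBy W'.Point (Nat.card B : ℤ) := by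
    have hcard : Nat.card (B.map μ) = Nat.card B := by
      refine (Nat.card_eq_of_bijective (fun P : B => (⟨μ P, P, P.2, rfl⟩ : B.map μ)) ⟨?_, ?_⟩).symm
      · intro P Q hPQ
        refine Subtype.ext (sub_eq_zero.mp (eq_zero_of_mem_ker (f := μ) (n := Nat.card B)
          (hd.symm ▸ hBd.symm) ?_ (nsmul_eq_zero_of_mem (B.sub_mem P.2 Q.2))))
        rw [map_sub, sub_eq_zero]
        exact Subtype.mk.inj hPQ
      · rintro ⟨_, P, hP, rfl⟩
        exact ⟨⟨P, hP⟩, rfl⟩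
    have hle : B.map μ ≤ φ'.ker := by
      rintro _ ⟨P, hP, rfl⟩
      exact hP.2
    have := eq_inf_torsionBy_of_le hle
    rwa [hcard] at this
  have hBmap : ∀ (τ : QBar ≃+* QBar) {V V₁ : Affine QBar} (h : W.map (τ : QBar →+* QBar) = V)
      (h' : W₁.map (τ : QBar →+* QBar) = V₁), B.map (conjTo τ h).toAddMonoidHom =
        (conjHom τ h h' φ.hom).ker ⊓ AddSubgroup.torsionBy V.Point (Nat.card B : ℤ) := by
    intro τ V V₁ h h'
    conv_lhs => rw [hB₁]
    have := AddSubgroup.map_inf φ.hom.ker (AddSubgroup.torsionBy W.Point (Nat.card B : ℤ))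
      (conjTo τ h).toAddMonoidHom (conjTo τ h).injective
    rw [this, map_torsionBy, ker_conjHom]
  obtain ⟨ν, hν, hνφ, hνcyc, hνcard⟩ := exists_cyclic_factor hμ hφr hφ'r hd hφm hφ'm hd0 hm0 hmd
    (b := Nat.card B) rfl hk.symm
  refine ⟨k, Dvd.intro_left _ hk.symm, ?_, ?_⟩
  · rw [hmk]
    refine isRational_sup hμ hd hd0 rfl hB0 hBd fun τ => ?_
    rcases hτ τ with h | h
    · obtain ⟨e, e', e₁, e₁'⟩ := hfix τ h
      refine Or.inl ⟨e, e', ?_, μ_fix τ h e e'⟩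
      rw [hBmap _ e e₁, φ_fix τ h, ← hB₁]
    · obtain ⟨e, e', e₁, e₁'⟩ := hswap τ h
      refine Or.inr ⟨e, e', ?_, μ_swap τ h e e'⟩
      rw [hBmap _ e e₁, φ_swap τ h, ← hB₂]
  · refine isRational_of_isAddCyclic_ker hν hνcard fun τ => ?_
    rcases hτ τ with h | h
    · obtain ⟨e, e', e₁, e₁'⟩ := hfix τ h
      refine Or.inl ⟨e₁, e₁', ?_⟩
      have key : ∀ P, conjHom _ e₁ e₁' ν (φ.hom P) = k • φ' (conjHom _ e e' μ P) := fun P => by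
        conv_lhs => rw [← φ_fix τ h e e₁]
        rw [conjHom_comp, conjHom_nsmul_comp _ e e' e₁' (g := φ') (e := ν.comp φ.hom) hνφ,
          φ'_fix τ h]
      refine (μ_fix τ h e e').imp (fun hs R => ?_) (fun hs R => ?_)
      all_goals
        obtain ⟨P, rfl⟩ := hφr.surjective R
        rw [key, hs, hνφ]
      rw [map_neg, smul_neg]
    · obtain ⟨e, e', e₁, e₁'⟩ := hswap τ h
      refine Or.inr ⟨e₁, e₁', ?_⟩
      have key : ∀ P, conjHom _ e₁ e₁' ν (φ' P) = k • φ.hom (conjHom _ e e' μ P) := fun P => by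
        conv_lhs => rw [← φ_swap τ h e e₁]
        rw [conjHom_comp, conjHom_nsmul_comp _ e e' e₁' (g := φ') (e := ν.comp φ.hom) hνφ,
          φ'_swap τ h]
      have hkd : k ^ 2 * d = d * k * k := by ring
      refine (μ_swap τ h e e').imp (fun hs R => ?_) (fun hs R => ?_)
      all_goals
        obtain ⟨P, rfl⟩ := hφr.surjective R
        rw [hνφ, map_nsmul, key, hs, hkd, mul_nsmul, mul_nsmul]
        simp only [map_neg, smul_neg, map_nsmul]

end RationalPoints

end EllCurve

theorem mainTheorem3 (m d : ℕ) (hm : 0 < m) (hd : 0 < d) (hmd : Nat.Coprime m d)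
    (K : IntermediateField ℚ QBar) (hK : Module.finrank ℚ K = 2)
    (E E₁ : WeierstrassCurve K) [E.IsElliptic] [E₁.IsElliptic]
    (hCM : ¬ EllCurve.HasCM E) (hE : EllCurve.IsQCurveOfDegree E d)
    (φ : EllCurve.Isogeny K (E.baseChange QBar) (E₁.baseChange QBar))
    (hφ : φ.IsCyclicOfDegree m) :
    ∃ k : ℕ, k ∣ m ∧
      EllCurve.CorrespondsToRationalPoint E (m / k * d) d ∧
      EllCurve.CorrespondsToRationalPointPlus E₁ (k ^ 2 * d) := by
  obtain ⟨σ, hσ1, μ, hμcyc, hμd⟩ := hE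
  have : Algebra.IsQuadraticExtension ℚ K := ⟨hK⟩
  have hcard : Nat.card (K ≃ₐ[ℚ] K) = 2 := (IsGalois.card_aut_eq_finrank ℚ K).trans hK
  have hσ : ∀ a, σ (σ a) = a := fun a => by
    have h := pow_card_eq_one' (x := σ)
    rw [hcard, sq] at h
    exact DFunLike.congr_fun h a
  have hdich : ∀ ρ : K ≃ₐ[ℚ] K, ρ = 1 ∨ ρ = σ := fun ρ => by
    obtain ⟨ρ', -, hρ'⟩ := (Nat.card_eq_two_iff' 1).mp hcard
    by_cases hρ : ρ = 1
    · exact Or.inl hρ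
    · exact Or.inr ((hρ' ρ hρ).trans (hρ' σ hσ1).symm)
  have hτ : ∀ τ : QBar ≃ₐ[ℚ] QBar, (∀ a : K, τ (algebraMap K QBar a) = algebraMap K QBar a) ∨
      ∀ a : K, τ (algebraMap K QBar a) = algebraMap K QBar (σ a) := fun τ => by
    have h : ∀ a, algebraMap K QBar (τ.restrictNormal K a) = τ (algebraMap K QBar a) :=
      τ.restrictNormal_commutes K
    refine (hdich (τ.restrictNormal K)).imp (fun hρ a => ?_) (fun hρ a => ?_)
    · rw [← h, hρ]; rfl
    · rw [← h, hρ]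
  have hconj : ∀ (τ : QBar ≃ₐ[ℚ] QBar) (ρ : K →+* K)
      (_ : ∀ a : K, τ (algebraMap K QBar a) = algebraMap K QBar (ρ a)) (F : WeierstrassCurve K),
      (F.baseChange QBar).map ((τ : QBar ≃+* QBar) : QBar →+* QBar) =
        (F.map ρ).baseChange QBar := fun τ ρ h F => by
    ext <;> exact h _
  have hmap1 : ∀ F : WeierstrassCurve K, F.map (RingHom.id K) = F := fun F => F.map_id
  have hσσ : ∀ F : WeierstrassCurve K,
      (F.map ((σ : K ≃+* K) : K →+* K)).map ((σ : K ≃+* K) : K →+* K) = F := fun F => by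
    ext <;> exact congrArg Subtype.val (hσ _)
  have hell : ∀ (F : WeierstrassCurve K) [F.IsElliptic], (F.baseChange QBar).IsElliptic :=
    fun F _ => inferInstanceAs (F.map (algebraMap K QBar)).IsElliptic
  have := hell E
  have := hell E₁
  have := hell (E.map ((σ : K ≃+* K) : K →+* K))
  have := hell (E₁.map ((σ : K ≃+* K) : K →+* K))
  -- The instances `Algebra ℚ QBar` of the algebraic closure and of a field of characteristic zero
  -- differ.
  have : Normal ℚ QBar := by
    have h := @IsAlgClosure.normal ℚ (AlgebraicClosure ℚ) _ _
      (AlgebraicClosure.instAlgebra ℚ) inferInstance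
    convert h
    exact Subsingleton.elim _ _
  obtain ⟨k, hkm, ⟨x, hxW, hx⟩, ⟨y, hyW, hy⟩⟩ := EllCurve.exists_rational_points
    (W := E.baseChange QBar) (W' := (E.map ((σ : K ≃+* K) : K →+* K)).baseChange QBar)
    (W₁ := E₁.baseChange QBar) (W₁' := (E₁.map ((σ : K ≃+* K) : K →+* K)).baseChange QBar)
    hσ
    (fun τ h => by
      have h' := fun F => (hconj τ (RingHom.id K) h F).trans (by rw [hmap1])
      exact ⟨h' _, h' _, h' _, h' _⟩)
    (fun τ h => by
      have h' := hconj τ ((σ : K ≃+* K) : K →+* K) h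
      exact ⟨h' _, (h' _).trans (by rw [hσσ]), h' _, (h' _).trans (by rw [hσσ])⟩)
    hτ (τ₀ := σ.liftNormal QBar) (σ.liftNormal_commutes QBar)
    (fun f hf => by
      obtain ⟨ψ, rfl⟩ := hf.exists_isogeny
      by_contra! h
      exact hCM ⟨ψ, h⟩)
    μ.isRatHom hμd hd φ hφ hm hmd
  have hj : ∀ F : WeierstrassCurve K, ∀ [F.IsElliptic], ∀ {n : ℕ} (z : EllCurve.Enhanced n),
      z.W = F.baseChange QBar → z.W.j = algebraMap K QBar F.j := by
    rintro F _ n ⟨V, hV, -, -, -⟩ (rfl : V = _)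
    exact F.map_j _
  exact ⟨k, hkm, ⟨x, hx, hj E x hxW⟩, ⟨y, hy, hj E₁ y hyW⟩⟩
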